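/- Let $D\ge 1$ be an integer, $I=[0,1]$, and let $\mathbb{T}^D=\mathbb{R}^D/\mathbb{Z}^D$ carry Lebesgue measure $\mathrm{Leb}$ (of total mass one) and the metric $d(\cdot,\cdot)$ induced by the Euclidean metric of $\mathbb{R}^D$; $\mathbb{T}^D\times I$ carries the maximum metric. For $\kappa>0$ and $\rho\in\mathbb{R}^D$ let \[ F_\kappa:\mathbb{T}^D\times I\to\mathbb{T}^D\times I,\qquad F_\kappa(\theta,x)=\Bigl(\theta+\rho \bmod 1,\ \tanh(\kappa x)\cdot\frac1D\sum_{i=1}^D\sin(\pi\theta_i)\Bigr), \] where $\theta_i\in[0,1)$. Let $\mathcal{A}=\bigcap_{n\in\mathbb{N}}F_\kappa^n(\mathbb{T}^D\times I)$ be its global attractor, let $\varphi^+(\theta)=\sup\{x\in I\mid(\theta,x)\in\mathcal{A}\}$ be the upper bounding graph, let $\Phi^+=\{(\theta,\varphi^+(\theta))\mid\theta\in\mathbb{T}^D\}$ be the corresponding point set, and let $\mu_{\varphi^+}$ be the Borel measure on $\mathbb{T}^D\times I$ given by $\mu_{\varphi^+}(A)=\mathrm{Leb}(\pi_1(A\cap\Phi^+))$,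 where $\pi_1$ is the projection to $\mathbb{T}^D$. For constants $c>0$ and $d>1$ we say that $\rho$ is Diophantine with constants $c,d$ if $d(n\rho \bmod 1,0)\ge c\,n^{-d}$ for all integers $n\ge1$. For $s\ge 0$ let $\mathcal{H}^s$ be the $s$-dimensional Hausdorff measure. A finite Borel measure $\mu$ on a metric space $X$ is called exact dimensional with pointwise dimension $\delta$ if $\lim_{\varepsilon\to0}\frac{\log\mu(B_\varepsilon(x))}{\log\varepsilon}=\delta$ for $\mu$-almost every $x$, and its information dimension is $\lim_{\varepsilon\to0}\frac{\int\log\mu(B_\varepsilon(x))\,d\mu(x)}{\log\varepsilon}$ if this limit exists. A Borel set $A\subseteq X$ is countably $D$-rectifiable if there are Lipschitz maps $g_i:A_i\to X$, $A_i\subseteq\mathbb{R}^D$, $i\in\mathbb{N}$, with $\mathcal{H}^D(A\setminus\bigcup_i g_i(A_i))=0$; the measure $\mu$ is $D$-rectifiable if $\mu=\Theta\,\mathcal{H}^D|_A$ for some countably $D$-rectifiable $A$ and some Borel density $\Theta:A\to[0,\infty)$. Statement. Let $c>0$ and $d>1$. There is $D_0=D_0(c,d)$, and for every $D\ge1$ there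 is $\kappa_0=\kappa_0(c,d,D)$, such that for all $\kappa>0$ with $\kappa\ge\kappa_0$ and all $\rho\in\mathbb{R}^D$ that are Diophantine with constants $c,d$ the following hold. - $\Phi^+$ has Hausdorff dimension $D$. - The $D$-dimensional Hausdorff measure of $\Phi^+$ is infinite if $D=1$ and finite if $D\ge D_0$. - $\mu_{\varphi^+}$ is exact dimensional with pointwise dimension $D$. - The information dimension of $\mu_{\varphi^+}$ exists and equals $D$. - $\mu_{\varphi^+}$ is $D$-rectifiable. -/

import Mathlib

open MeasureTheory Filter Set Topology
open scoped ENNReal NNReal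

namespace PinchedSkew

noncomputable section

/-! ### Dimensions and rectifiability in metric spaces -/

section Dimensions

variable {X : Type*} [MetricSpace X] [MeasurableSpace X]

/-- The lower pointwise dimension `liminf_{ε → 0} log μ(B_ε(x)) / log ε` (meaningful for `x` in the
support of the finite measure `μ`). -/
def lowerPointwiseDim (μ : Measure X) (x : X) : EReal :=
  liminf (fun ε : ℝ => ((Real.log (μ.real (Metric.ball x ε)) / Real.log ε : ℝ) : EReal)) (𝓝[>] 0)

/-- The upper pointwise dimension `limsup_{ε → 0} log μ(B_ε(x)) / log ε` (meaningful for `x` in the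
support of the finite measure `μ`). -/
def upperPointwiseDim (μ : Measure X) (x : X) : EReal :=
  limsup (fun ε : ℝ => ((Real.log (μ.real (Metric.ball x ε)) / Real.log ε : ℝ) : EReal)) (𝓝[>] 0)

/-- `x` is in the support of `μ` and the pointwise dimension of `μ` at `x` exists and equals `d`. -/
def HasPointwiseDim (μ : Measure X) (x : X) (d : EReal) : Prop :=
  x ∈ μ.support ∧ lowerPointwiseDim μ x = d ∧ upperPointwiseDim μ x = d

/-- `μ` is exact dimensional with pointwise dimension `d`: the pointwise dimension exists and is
equal to the constant `d` almost everywhere. -/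
def IsExactDimensional (μ : Measure X) (d : EReal) : Prop :=
  ∀ᵐ x ∂μ, HasPointwiseDim μ x d

/-- The lower information dimension `liminf_{ε → 0} (∫ log μ(B_ε(x)) dμ(x)) / log ε`. -/
def lowerInformationDim (μ : Measure X) : EReal :=
  liminf (fun ε : ℝ =>
    (((∫ x, Real.log (μ.real (Metric.ball x ε)) ∂μ) / Real.log ε : ℝ) : EReal)) (𝓝[>] 0)

/-- The upper information dimension `limsup_{ε → 0} (∫ log μ(B_ε(x)) dμ(x)) / log ε`. -/
def upperInformationDim (μ : Measure X) : EReal :=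
  limsup (fun ε : ℝ =>
    (((∫ x, Real.log (μ.real (Metric.ball x ε)) ∂μ) / Real.log ε : ℝ) : EReal)) (𝓝[>] 0)

/-- The information dimension of `μ` exists and equals `d`; the integrals in its definition are
required to be genuine (finite) integrals. -/
def HasInformationDim (μ : Measure X) (d : EReal) : Prop :=
  (∀ ε : ℝ, 0 < ε → Integrable (fun x => Real.log (μ.real (Metric.ball x ε))) μ) ∧
    lowerInformationDim μ = d ∧ upperInformationDim μ = d

variable [BorelSpace X]

/-- A Borel set `A` is countably `D`-rectifiable if, up to an `ℋ^D`-null set, it is covered by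
countably many Lipschitz images of subsets of `ℝ^D`. -/
def IsCountablyRectifiable (D : ℕ) (A : Set X) : Prop :=
  MeasurableSet A ∧
    ∃ (s : ℕ → Set (EuclideanSpace ℝ (Fin D))) (g : ∀ i, s i → X),
      (∀ i, ∃ K : ℝ≥0, LipschitzWith K (g i)) ∧
      μH[(D : ℝ)] (A \ ⋃ i, range (g i)) = 0

/-- A finite Borel measure is `D`-rectifiable if it is of the form `Θ · ℋ^D|_A` for a countably
`D`-rectifiable set `A` and a Borel density `Θ ≥ 0`. -/
def IsRectifiableMeasure (D : ℕ) (μ : Measure X) : Prop :=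
  IsFiniteMeasure μ ∧ ∃ A : Set X, IsCountablyRectifiable D A ∧
    ∃ Θ : X → ℝ≥0, Measurable Θ ∧
      μ = ((μH[(D : ℝ)] : Measure X).restrict A).withDensity (fun x => (Θ x : ℝ≥0∞))

end Dimensions

/-! ### The torus and the maps `F_κ` -/

/-- The torus `𝕋^D = ℝ^D / ℤ^D` with the metric induced by the Euclidean metric of `ℝ^D`. -/
abbrev Torus (D : ℕ) : Type := PiLp 2 (fun _ : Fin D => UnitAddCircle)

/-- The unit interval `I = [0,1]`. -/
abbrev I : Type := unitInterval

/-- Lebesgue measure on the torus (of total mass one). -/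
def leb (D : ℕ) : Measure (Torus D) :=
  (volume : Measure (Fin D → UnitAddCircle)).map (WithLp.toLp 2)

/-- The class `ρ mod 1` in the torus of `ρ ∈ ℝ^D`. -/
def toTorus {D : ℕ} (ρ : Fin D → ℝ) : Torus D :=
  WithLp.toLp 2 (fun i => (ρ i : UnitAddCircle))

/-- The rotation `ω(θ) = θ + ρ mod 1`. -/
def rot {D : ℕ} (ρ : Fin D → ℝ) (θ : Torus D) : Torus D := θ + toTorus ρ

/-- The Diophantine condition `d(ω^n(θ_*), θ_*) ≥ c n^{-d}` for all `n ≥ 1`, where `θ_* = 0`. -/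
def IsDiophantine {D : ℕ} (c d : ℝ) (ρ : Fin D → ℝ) : Prop :=
  ∀ n : ℕ, 1 ≤ n → c * (n : ℝ) ^ (-d) ≤ dist ((rot ρ)^[n] 0) 0

/-- `sin (π t)`, where `t ∈ [0,1)` is the representative of the given point of the circle. -/
def sinPi : UnitAddCircle → ℝ := AddCircle.liftIco 1 0 (fun t : ℝ => Real.sin (Real.pi * t))

/-- The value `tanh(κ x) · (1/D) · ∑ sin(π θ_i)`. -/
def fibreVal {D : ℕ} (κ : ℝ) (θ : Torus D) (x : ℝ) : ℝ :=
  Real.tanh (κ * x) * ((1 / (D : ℝ)) * ∑ i, sinPi (θ i))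

lemma sinPi_mem (t : UnitAddCircle) : sinPi t ∈ Set.Icc (0 : ℝ) 1 := by
  have h := (AddCircle.equivIco (1 : ℝ) 0 t).2
  refine ⟨?_, Real.sin_le_one _⟩
  refine Real.sin_nonneg_of_nonneg_of_le_pi ?_ ?_
  · exact mul_nonneg Real.pi_pos.le h.1
  · have h2 := h.2
    nlinarith [Real.pi_pos]

lemma avg_mem {D : ℕ} (θ : Torus D) :
    (1 / (D : ℝ)) * ∑ i, sinPi (θ i) ∈ Set.Icc (0 : ℝ) 1 := by
  have h0 : 0 ≤ ∑ i, sinPi (θ i) := Finset.sum_nonneg fun i _ => (sinPi_mem _).1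
  have h1 : ∑ i, sinPi (θ i) ≤ D := by
    calc ∑ i, sinPi (θ i) ≤ ∑ _i : Fin D, (1 : ℝ) := Finset.sum_le_sum fun i _ => (sinPi_mem _).2
      _ = D := by simp
  refine ⟨by positivity, ?_⟩
  rw [one_div, inv_mul_eq_div]
  exact div_le_one_of_le₀ h1 (by positivity)

lemma tanh_mono : Monotone Real.tanh := by
  intro x y h
  rw [Real.tanh_eq_sinh_div_cosh, Real.tanh_eq_sinh_div_cosh,
    div_le_div_iff₀ (Real.cosh_pos x) (Real.cosh_pos y)]
  have := Real.sinh_sub x y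
  have h2 : Real.sinh (x - y) ≤ 0 := Real.sinh_nonpos_iff.2 (by linarith)
  linarith

lemma fibreVal_mem {D : ℕ} {κ : ℝ} (hκ : 0 < κ) (θ : Torus D) (x : I) :
    fibreVal κ θ x ∈ Set.Icc (0 : ℝ) 1 := by
  have h := avg_mem θ
  have h0 : 0 ≤ Real.tanh (κ * x) := by
    have := tanh_mono (mul_nonneg hκ.le x.2.1)
    simpa using this
  exact ⟨mul_nonneg h0 h.1, mul_le_one₀ (Real.tanh_lt_one _).le h.1 h.2⟩

/-- The fibre map `F_{κ,θ} : [0,1] → [0,1]`. -/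
def fibreMap {D : ℕ} (κ : ℝ) (hκ : 0 < κ) (θ : Torus D) (x : I) : I :=
  ⟨fibreVal κ θ x, fibreVal_mem hκ θ x⟩

/-- The map `F_κ(θ,x) = (θ + ρ mod 1, tanh(κ x) · (1/D) · ∑ sin(π θ_i))` on `𝕋^D × [0,1]`; the
product carries the maximum metric. -/
def F {D : ℕ} (ρ : Fin D → ℝ) (κ : ℝ) (hκ : 0 < κ) (p : Torus D × I) : Torus D × I :=
  (rot ρ p.1, fibreMap κ hκ p.1 p.2)

/-- The global attractor `⋂ₙ F_κ^n(𝕋^D × [0,1])`. -/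
def attractor {D : ℕ} (ρ : Fin D → ℝ) (κ : ℝ) (hκ : 0 < κ) : Set (Torus D × I) :=
  ⋂ n : ℕ, (F ρ κ hκ)^[n] '' univ

/-- The upper bounding graph `φ⁺(θ) = sup {x ∈ [0,1] | (θ,x) ∈ attractor}`, as a function. -/
def phiPlus {D : ℕ} (ρ : Fin D → ℝ) (κ : ℝ) (hκ : 0 < κ) (θ : Torus D) : I :=
  sSup {x : I | (θ, x) ∈ attractor ρ κ hκ}

/-- The upper bounding graph as a point set `Φ⁺ = {(θ, φ⁺(θ))}`. -/
def graphPlus {D : ℕ} (ρ : Fin D → ℝ) (κ : ℝ) (hκ : 0 < κ) : Set (Torus D × I) :=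
  range fun θ => (θ, phiPlus ρ κ hκ θ)

/-- The measure `μ_{φ⁺}`: Lebesgue measure on `𝕋^D` lifted to `Φ⁺`. By `muPlus_apply` below, it is
given by `μ_{φ⁺}(A) = Leb(π₁(A ∩ Φ⁺))` on Borel sets `A`. -/
def muPlus {D : ℕ} (ρ : Fin D → ℝ) (κ : ℝ) (hκ : 0 < κ) : Measure (Torus D × I) :=
  (leb D).map fun θ => (θ, phiPlus ρ κ hκ θ)

/-! ### `φ⁺` is Borel measurable, so that the measure `μ_{φ⁺}` is the intended one -/

/-- The iterated upper bounding lines. -/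
def upperLine {D : ℕ} (ρ : Fin D → ℝ) (κ : ℝ) (hκ : 0 < κ) : ℕ → Torus D → I
  | 0, _ => 1
  | n + 1, θ => fibreMap κ hκ (θ - toTorus ρ) (upperLine ρ κ hκ n (θ - toTorus ρ))

lemma upperLine_succ {D : ℕ} (ρ : Fin D → ℝ) (κ : ℝ) (hκ : 0 < κ) (n : ℕ) :
    upperLine ρ κ hκ (n + 1) = fun θ =>
      fibreMap κ hκ (θ - toTorus ρ) (upperLine ρ κ hκ n (θ - toTorus ρ)) := by
  funext θ
  rw [upperLine]

lemma continuous_sinPi : Continuous sinPi := by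
  refine AddCircle.liftIco_zero_continuous (by simp) ?_
  fun_prop

lemma continuous_fibreMap {D : ℕ} (κ : ℝ) (hκ : 0 < κ) :
    Continuous fun p : Torus D × I => fibreMap κ hκ p.1 p.2 := by
  have htanh : Continuous Real.tanh := by
    have : Real.tanh = fun x => Real.sinh x / Real.cosh x := by
      funext x; exact Real.tanh_eq_sinh_div_cosh x
    rw [this]
    exact Real.continuous_sinh.div Real.continuous_cosh fun x => (Real.cosh_pos x).ne'
  refine Continuous.subtype_mk ?_ _
  refine (htanh.comp (by fun_prop)).mul (continuous_const.mul ?_)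
  refine continuous_finsetSum _ fun i _ => continuous_sinPi.comp ?_
  fun_prop

lemma monotone_fibreMap {D : ℕ} (κ : ℝ) (hκ : 0 < κ) (θ : Torus D) :
    Monotone (fibreMap κ hκ θ) := by
  intro x y h
  have h' : (x : ℝ) ≤ y := h
  exact mul_le_mul_of_nonneg_right (tanh_mono (mul_le_mul_of_nonneg_left h' hκ.le)) (avg_mem θ).1

lemma fibreMap_zero {D : ℕ} (κ : ℝ) (hκ : 0 < κ) (θ : Torus D) : fibreMap κ hκ θ 0 = 0 := by
  apply Subtype.ext
  simp [fibreMap, fibreVal]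

lemma continuous_upperLine {D : ℕ} (ρ : Fin D → ℝ) (κ : ℝ) (hκ : 0 < κ) (n : ℕ) :
    Continuous (upperLine ρ κ hκ n) := by
  induction n with
  | zero => exact continuous_const
  | succ n ih =>
    have h : Continuous fun θ : Torus D => θ - toTorus ρ := continuous_sub_right _
    have h2 : Continuous fun θ : Torus D =>
        (θ - toTorus ρ, upperLine ρ κ hκ n (θ - toTorus ρ)) := h.prodMk (ih.comp h)
    have h3 := (continuous_fibreMap (D := D) κ hκ).comp h2
    rw [upperLine_succ]
    simpa only [Function.comp_def] using h3

lemma image_iterate {D : ℕ} (ρ : Fin D → ℝ) (κ : ℝ) (hκ : 0 < κ) (n : ℕ) :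
    (F ρ κ hκ)^[n] '' univ = {p | p.2 ≤ upperLine ρ κ hκ n p.1} := by
  induction n with
  | zero =>
    ext p
    simpa [upperLine] using unitInterval.le_one'
  | succ n ih =>
    rw [Function.iterate_succ', image_comp, ih]
    ext ⟨θ, x⟩
    constructor
    · rintro ⟨⟨η, y⟩, hy, he⟩
      have h1 : rot ρ η = θ := congrArg Prod.fst he
      have h2 : fibreMap κ hκ η y = x := congrArg Prod.snd he
      have h3 : θ - toTorus ρ = η := by rw [← h1, rot, add_sub_cancel_right]
      rw [mem_ofPred_eq, upperLine_succ]
      change x ≤ fibreMap κ hκ (θ - toTorus ρ) (upperLine ρ κ hκ n (θ - toTorus ρ))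
      rw [h3, ← h2]
      exact monotone_fibreMap κ hκ η hy
    · intro hx
      rw [mem_ofPred_eq, upperLine_succ] at hx
      change x ≤ fibreMap κ hκ (θ - toTorus ρ) (upperLine ρ κ hκ n (θ - toTorus ρ)) at hx
      have hc : Continuous (fibreMap κ hκ (θ - toTorus ρ)) := by
        have h3 := (continuous_fibreMap (D := D) κ hκ).comp
          (Continuous.prodMk_right (θ - toTorus ρ))
        simpa only [Function.comp_def] using h3
      have h0 : (0 : I) ≤ upperLine ρ κ hκ n (θ - toTorus ρ) := unitInterval.nonneg'
      obtain ⟨y, hy, hyx⟩ := intermediate_value_Icc h0 hc.continuousOn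
        ⟨by rw [fibreMap_zero]; exact unitInterval.nonneg', hx⟩
      refine ⟨(θ - toTorus ρ, y), hy.2, ?_⟩
      change (rot ρ (θ - toTorus ρ), fibreMap κ hκ (θ - toTorus ρ) y) = (θ, x)
      rw [hyx, rot, sub_add_cancel]

lemma phiPlus_eq_iInf {D : ℕ} (ρ : Fin D → ℝ) (κ : ℝ) (hκ : 0 < κ) (θ : Torus D) :
    phiPlus ρ κ hκ θ = ⨅ n, upperLine ρ κ hκ n θ := by
  have h : {x : I | (θ, x) ∈ attractor ρ κ hκ} = Iic (⨅ n, upperLine ρ κ hκ n θ) := by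
    ext x
    simp only [attractor, image_iterate, mem_iInter, mem_ofPred_eq, mem_Iic, le_iInf_iff]
  rw [phiPlus, h, csSup_Iic]

lemma measurable_phiPlus {D : ℕ} (ρ : Fin D → ℝ) (κ : ℝ) (hκ : 0 < κ) :
    Measurable (phiPlus ρ κ hκ) := by
  have h : phiPlus ρ κ hκ = fun θ => ⨅ n, upperLine ρ κ hκ n θ :=
    funext fun θ => phiPlus_eq_iInf ρ κ hκ θ
  rw [h]
  exact Measurable.iInf fun n => (continuous_upperLine ρ κ hκ n).measurable

/-- `μ_{φ⁺}(A) = Leb(π₁(A ∩ Φ⁺))` for all Borel sets `A`. -/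
lemma muPlus_apply {D : ℕ} (ρ : Fin D → ℝ) (κ : ℝ) (hκ : 0 < κ) {A : Set (Torus D × I)}
    (hA : MeasurableSet A) :
    muPlus ρ κ hκ A = leb D (Prod.fst '' (A ∩ graphPlus ρ κ hκ)) := by
  have hm : Measurable fun θ : Torus D => (θ, phiPlus ρ κ hκ θ) :=
    measurable_id.prodMk (measurable_phiPlus ρ κ hκ)
  rw [muPlus, Measure.map_apply hm hA]
  congr 1
  ext θ
  constructor
  · intro h
    exact ⟨_, ⟨h, θ, rfl⟩, rfl⟩
  · rintro ⟨_, ⟨h, η, rfl⟩, rfl⟩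
    exact h

end

end PinchedSkew

/-! The driving term `avgSin` vanishes at 0 and is at least `‖θ‖ / D`, so `φ⁺` can only misbehave
near the points `i • ρ`, `i ≥ 1`. Write `κ = b ^ 64`. The set `regular j` consists of the points at
distance at least `b⁻¹ ^ (i + j)` from each `i • ρ`; its complement has measure at most `b⁻¹ ^ j`,
so almost every point lies in some `regular j`. Everything rests on one estimate: on `regular j` the
function `φ⁺` is Lipschitz with constant `b ^ (529 + 8 * j)` (`abs_phiPlus_sub_le`).

For this estimate, follow the iterated upper line along the backward orbit of `θ`. As `tanh u ≥ min
u 1 / 2`, each forward step lowers minus the logarithm of the line by `log κ`, though not below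
zero, up to an added cost `log 2 - log avgSin`. The Diophantine condition keeps close visits to 0
far apart in time, so `s` steps cost at most `(2 s + j + 2) log b` (`sum_neg_log_avgSin_le`). Hence
the line is below `b ^ (-32)` at no more than `(66 + 2 k + j) / 32` of the first `k` backward steps
(`card_lowIndices_le`). When neither of two compared orbits is low, `tanh` is saturated and the
difference shrinks by `1 / κ`; otherwise it grows by at most `κ`. Contraction prevails, and the
difference of the orbits is controlled by a geometric series (`abs_upperLine_sub_le`).

Consequences. Around a point of `regular j`, a fixed proportion of every small ball lies in `regular
(j + 1)`, where the graph is Lipschitz; thus `μ(B_ε)` is comparable to `ε ^ D`, with a logarithmic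
error linear in `j`. This gives the pointwise dimension, and the information dimension because the
index `j` is integrable. The graphs over the regular sets are Lipschitz images of subsets of `ℝ^D`,
which gives rectifiability. The exceptional set is so thin that its graph is null for `ℋ^s` with `s
> 1`, whence the Hausdorff dimension. The shells between consecutive regular sets lie in balls so
small that for `D ≥ 16` their volume beats the growing Lipschitz constants, so `ℋ^D` is finite.

For `D = 1`, `φ⁺` vanishes on the dense set of the `n • ρ` but is at least some `δ > 0` at
infinitely many points. Going right from such a point to a zero, `φ⁺` takes all values in `(0, δ)`
(`exists_phiPlus_eq`), so infinitely many disjoint arcs each contribute length at least `δ`. -/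

namespace PinchedSkew

/-! ### Sequences of real numbers -/

/-- A set of natural numbers below `N` with gaps at least `g` has at most `1 + N / g` elements. -/
lemma card_le_of_separated {N : ℕ} {g : ℝ} (hg : 0 < g) (A : Finset ℕ) (hA : ∀ t ∈ A, t < N)
    (hsep : ∀ s ∈ A, ∀ t ∈ A, s < t → g ≤ (t : ℝ) - s) : (A.card : ℝ) ≤ 1 + N / g := by
  -- Cut the line into intervals of length `g`; each contains at most one element of `A`.
  have hinj : Set.InjOn (fun t : ℕ => ⌊(t : ℝ) / g⌋₊) A := by
    have key : ∀ s ∈ A, ∀ t ∈ A, s < t → ⌊(s : ℝ) / g⌋₊ ≠ ⌊(t : ℝ) / g⌋₊ := by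
      intro s hs t ht hst he
      have h1 : ((t : ℝ) / g) < ⌊(t : ℝ) / g⌋₊ + 1 := Nat.lt_floor_add_one _
      have h2 : (⌊(s : ℝ) / g⌋₊ : ℝ) ≤ s / g := Nat.floor_le (by positivity)
      rw [← he] at h1
      have h3 : ((t : ℝ) - s) / g < 1 := by rw [sub_div]; linarith
      rw [div_lt_one hg] at h3
      linarith [hsep s hs t ht hst]
    intro s hs t ht he
    rcases lt_trichotomy s t with h | h | h
    · exact absurd he (key s hs t ht h)
    · exact h
    · exact absurd he.symm (key t ht s hs h)
  have hcard : A.card ≤ (Finset.range (⌊(N : ℝ) / g⌋₊ + 1)).card := by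
    refine Finset.card_le_card_of_injOn _ ?_ hinj
    intro t ht
    simp only [Finset.coe_range, mem_Iio]
    refine Nat.lt_succ_of_le (Nat.floor_le_floor ?_)
    have : (t : ℝ) ≤ N := by exact_mod_cast (hA t ht).le
    gcongr
  rw [Finset.card_range] at hcard
  have h4 : (A.card : ℝ) ≤ ⌊(N : ℝ) / g⌋₊ + 1 := by exact_mod_cast hcard
  have h5 : (⌊(N : ℝ) / g⌋₊ : ℝ) ≤ N / g := Nat.floor_le (by positivity)
  linarith

/-- A layer cake bound for sums of a function whose superlevel sets have large gaps. -/
lemma sum_le_of_separated {N : ℕ} {ψ : ℕ → ℝ} {B q Ψ : ℝ} (hB : 0 < B) (hq : 0 < q) (hq1 : q < 1)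
    (hΨ : ∀ t < N, ψ t ≤ Ψ) (hΨ0 : 0 ≤ Ψ)
    (hsep : ∀ m : ℕ, ∀ s t : ℕ, s < t → t < N → (m : ℝ) < ψ s → (m : ℝ) < ψ t →
      (B * q ^ m)⁻¹ ≤ (t : ℝ) - s) :
    ∑ t ∈ Finset.range N, ψ t ≤ B / (1 - q) * N + Ψ + 1 := by
  classical
  -- The number of naturals `m < ψ t` is `⌈ψ t⌉₊`, which dominates `ψ t` also when `ψ t` is
  -- negative.
  have h1 : ∀ t ∈ Finset.range N, ψ t ≤
      ∑ m ∈ Finset.range ⌈Ψ⌉₊, if (m : ℝ) < ψ t then (1 : ℝ) else 0 := by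
    intro t ht
    rw [Finset.mem_range] at ht
    have hsub : Finset.range ⌈ψ t⌉₊ ⊆
        (Finset.range ⌈Ψ⌉₊).filter fun m : ℕ => (m : ℝ) < ψ t := by
      intro m hm
      rw [Finset.mem_range] at hm
      rw [Finset.mem_filter, Finset.mem_range]
      exact ⟨hm.trans_le (Nat.ceil_mono (hΨ t ht)), Nat.lt_ceil.1 hm⟩
    have hc := Finset.card_le_card hsub
    rw [Finset.card_range] at hc
    rw [Finset.sum_boole]
    exact (Nat.le_ceil _).trans (by exact_mod_cast hc)
  have h2 : ∀ m ∈ Finset.range ⌈Ψ⌉₊,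
      (∑ t ∈ Finset.range N, if (m : ℝ) < ψ t then (1 : ℝ) else 0) ≤ 1 + N * (B * q ^ m) := by
    intro m _
    rw [Finset.sum_boole]
    have h := card_le_of_separated (N := N) (g := (B * q ^ m)⁻¹) (by positivity)
      ((Finset.range N).filter fun t => (m : ℝ) < ψ t)
      (fun t ht => by simpa using (Finset.mem_filter.1 ht).1)
      (fun s hs t ht hst => hsep m s t hst (by simpa using (Finset.mem_filter.1 ht).1)
        (Finset.mem_filter.1 hs).2 (Finset.mem_filter.1 ht).2)
    rwa [div_inv_eq_mul] at h
  have h3 : ∑ m ∈ Finset.range ⌈Ψ⌉₊, q ^ m ≤ 1 / (1 - q) := by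
    rw [geom_sum_eq hq1.ne, ← neg_div_neg_eq, neg_sub, neg_sub]
    have : 0 < 1 - q := by linarith
    gcongr
    have : 0 < q ^ ⌈Ψ⌉₊ := by positivity
    linarith
  calc ∑ t ∈ Finset.range N, ψ t
      ≤ ∑ t ∈ Finset.range N, ∑ m ∈ Finset.range ⌈Ψ⌉₊, (if (m : ℝ) < ψ t then (1 : ℝ) else 0) :=
        Finset.sum_le_sum h1
    _ = ∑ m ∈ Finset.range ⌈Ψ⌉₊, ∑ t ∈ Finset.range N, (if (m : ℝ) < ψ t then (1 : ℝ) else 0) :=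
        Finset.sum_comm
    _ ≤ ∑ m ∈ Finset.range ⌈Ψ⌉₊, (1 + N * (B * q ^ m)) := Finset.sum_le_sum h2
    _ = ⌈Ψ⌉₊ + N * B * ∑ m ∈ Finset.range ⌈Ψ⌉₊, q ^ m := by
        rw [Finset.sum_add_distrib, Finset.mul_sum]
        simp [mul_assoc]
    _ ≤ (Ψ + 1) + N * B * (1 / (1 - q)) := by
        gcongr
        exact (Nat.ceil_lt_add_one hΨ0).le
    _ = B / (1 - q) * N + Ψ + 1 := by ring

/-- Iterating a one-step bound backwards until the first index `s ≥ k` at which `w` is small bounds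
`w 0` and the number of indices `i ≤ k` at which `w` is large. -/
lemma count_large_le {w e : ℕ → ℝ} {n k : ℕ} {L : ℝ} (hL : 0 < L) (hkn : k ≤ n)
    (hw0 : ∀ i, 0 ≤ w i) (hwn : w n = 0)
    (hstep : ∀ i < n, w i ≤ max (w (i + 1) - 2 * L) 0 + e i) :
    ∃ s, k ≤ s ∧ s ≤ n ∧
      w 0 + L * (((Finset.range k).filter fun i => L < w (i + 1)).card + (s - k : ℝ)) ≤
        2 * L + ∑ i ∈ Finset.range s, e i := by
  classical
  -- There is no control of `w k` itself, so the recursion is started at a later index where `w` is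
  -- small; `n` always qualifies.
  have hex : ∃ s, k ≤ s ∧ w s ≤ L := ⟨n, hkn, by rw [hwn]; exact hL.le⟩
  obtain ⟨s, hks, hsL, hbad⟩ : ∃ s, k ≤ s ∧ w s ≤ L ∧ ∀ i, k ≤ i → i < s → L < w i := by
    obtain ⟨h1, h2⟩ := Nat.find_spec hex
    refine ⟨_, h1, h2, fun i hki his => ?_⟩
    by_contra hcon
    exact Nat.find_min hex his ⟨hki, not_lt.1 hcon⟩
  have hsn : s ≤ n := by
    by_contra hcon
    exact absurd (hbad n hkn (not_le.1 hcon)) (by rw [hwn]; exact not_lt.2 hL.le)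
  have htel : ∀ m ≤ n, w 0 + L * ((Finset.range m).filter fun i => L < w (i + 1)).card ≤
      w m + ∑ i ∈ Finset.range m, e i := by
    intro m
    induction m with
    | zero => intro _; simp
    | succ m ih =>
      intro hm
      have h := ih (by omega)
      have h2 := hstep m (by omega)
      rw [Finset.sum_range_succ, Finset.range_add_one, Finset.filter_insert]
      split_ifs with hc
      · rw [Finset.card_insert_of_notMem (by simp)]
        push_cast
        have h3 : max (w (m + 1) - 2 * L) 0 ≤ w (m + 1) - L :=
          max_le (by linarith) (by linarith)
        linarith
      · have h3 : max (w (m + 1) - 2 * L) 0 ≤ w (m + 1) := max_le (by linarith) (hw0 _)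
        linarith
  -- All indices of `[k, s)` are large, but the filter tests `w (i + 1)`, so only `Ico k (s - 1)` is
  -- gained. The lost index is why the final bound has `2 * L` rather than `L`.
  have hcard : ((Finset.range k).filter fun i => L < w (i + 1)).card + s ≤
      ((Finset.range s).filter fun i => L < w (i + 1)).card + k + 1 := by
    rcases hks.eq_or_lt with h | h
    · subst h; omega
    · have hsub : ((Finset.range k).filter fun i => L < w (i + 1)) ∪ Finset.Ico k (s - 1) ⊆
          (Finset.range s).filter fun i => L < w (i + 1) := by
        intro i hi
        rw [Finset.mem_union, Finset.mem_filter, Finset.mem_Ico, Finset.mem_range] at hi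
        rw [Finset.mem_filter, Finset.mem_range]
        rcases hi with hi | hi
        · exact ⟨by omega, hi.2⟩
        · exact ⟨by omega, hbad _ (by omega) (by omega)⟩
      have h2 := Finset.card_le_card hsub
      rw [Finset.card_union_of_disjoint, Nat.card_Ico] at h2
      · omega
      · rw [Finset.disjoint_left]
        intro i hi hi'
        simp only [Finset.mem_filter, Finset.mem_range, Finset.mem_Ico] at hi hi'
        omega
  refine ⟨s, hks, hsn, ?_⟩
  have h := htel s hsn
  have hcard' : (((Finset.range k).filter fun i => L < w (i + 1)).card : ℝ) + s ≤
      ((Finset.range s).filter fun i => L < w (i + 1)).card + k + 1 := by exact_mod_cast hcard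
  have h4 : L * (((Finset.range k).filter fun i => L < w (i + 1)).card + (s - k : ℝ)) ≤
      L * (((Finset.range s).filter fun i => L < w (i + 1)).card + 1) :=
    mul_le_mul_of_nonneg_left (by linarith) hL.le
  linarith

/-- Iterating `Δ i ≤ e + ℓ i * Δ (i + 1)`. -/
lemma le_sum_prod_of_step {Δ ℓ : ℕ → ℝ} {e : ℝ} {k : ℕ} (hℓ : ∀ i, 0 ≤ ℓ i)
    (hstep : ∀ i < k, Δ i ≤ e + ℓ i * Δ (i + 1)) :
    Δ 0 ≤ e * ∑ l ∈ Finset.range k, ∏ i ∈ Finset.range l, ℓ i +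
      (∏ i ∈ Finset.range k, ℓ i) * Δ k := by
  induction k with
  | zero => simp
  | succ k ih =>
    have h := ih fun i hi => hstep i (by omega)
    have h2 := hstep k (by omega)
    have h3 : 0 ≤ ∏ i ∈ Finset.range k, ℓ i := Finset.prod_nonneg fun i _ => hℓ i
    rw [Finset.sum_range_succ, Finset.prod_range_succ]
    nlinarith [mul_le_mul_of_nonneg_left h2 h3]

/-! ### The function `sin (π t)` on the circle, and the hyperbolic tangent -/

lemma exists_lift (t : UnitAddCircle) : ∃ x : ℝ, (x : UnitAddCircle) = t ∧ |x| = ‖t‖ ∧ |x| ≤ 1 / 2 := by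
  induction t using QuotientAddGroup.induction_on with
  | H x =>
    refine ⟨x - round x, ?_, ?_, abs_sub_round x⟩
    · have h : ((round x : ℝ) : UnitAddCircle) = 0 := by
        rw [AddCircle.coe_eq_zero_iff]
        exact ⟨round x, by simp⟩
      change ((x - round x : ℝ) : UnitAddCircle) = (x : UnitAddCircle)
      rw [AddCircle.coe_sub, h, sub_zero]
    · exact (UnitAddCircle.norm_eq).symm

/-- Passing to the representative in `[0, 1)` changes the sine by a sign only, so the absolute value
gives a formula valid for every representative. -/
lemma sinPi_coe (x : ℝ) : sinPi (x : UnitAddCircle) = |Real.sin (Real.pi * x)| := by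
  have h1 : (x : UnitAddCircle) = ((Int.fract x : ℝ) : UnitAddCircle) := by
    have h : ((⌊x⌋ : ℝ) : UnitAddCircle) = 0 := by
      rw [AddCircle.coe_eq_zero_iff]
      exact ⟨⌊x⌋, by simp⟩
    rw [← Int.self_sub_floor, AddCircle.coe_sub, h, sub_zero]
  have h2 : sinPi ((Int.fract x : ℝ) : UnitAddCircle) = Real.sin (Real.pi * Int.fract x) :=
    AddCircle.liftIco_zero_coe_apply ⟨Int.fract_nonneg x, Int.fract_lt_one x⟩
  have h3 : 0 ≤ Real.sin (Real.pi * Int.fract x) := by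
    refine Real.sin_nonneg_of_nonneg_of_le_pi
      (mul_nonneg Real.pi_pos.le (Int.fract_nonneg x)) ?_
    nlinarith [Real.pi_pos, Int.fract_lt_one x]
  rw [h1, h2, ← abs_of_nonneg h3]
  have h4 : Real.pi * Int.fract x = Real.pi * x - ⌊x⌋ * Real.pi := by
    rw [← Int.self_sub_floor]; ring
  rw [h4, Real.sin_sub_int_mul_pi, abs_mul, abs_zpow, abs_neg, abs_one, one_zpow, one_mul]

lemma abs_sinPi_sub_le (s t : UnitAddCircle) : |sinPi s - sinPi t| ≤ Real.pi * dist s t := by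
  obtain ⟨y, rfl, -, -⟩ := exists_lift t
  obtain ⟨z, hz, hz2, -⟩ := exists_lift (s - (y : UnitAddCircle))
  have hs : s = ((y + z : ℝ) : UnitAddCircle) := by
    rw [AddCircle.coe_add, hz]; abel
  rw [dist_eq_norm, ← hz2, hs, sinPi_coe, sinPi_coe]
  refine (abs_abs_sub_abs_le _ _).trans ?_
  have h := Real.abs_sin_sub_sin_le (Real.pi * (y + z)) (Real.pi * y)
  refine h.trans (le_of_eq ?_)
  rw [← mul_sub, add_sub_cancel_left, abs_mul, abs_of_pos Real.pi_pos]

lemma two_mul_norm_le_sinPi (t : UnitAddCircle) : 2 * ‖t‖ ≤ sinPi t := by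
  obtain ⟨x, rfl, hx, hx2⟩ := exists_lift t
  rw [← hx, sinPi_coe]
  have h : |Real.pi * x| ≤ Real.pi / 2 := by
    rw [abs_mul, abs_of_pos Real.pi_pos]
    nlinarith [Real.pi_pos]
  have h2 := Real.mul_abs_le_abs_sin h
  refine le_trans (le_of_eq ?_) h2
  rw [abs_mul, abs_of_pos Real.pi_pos]
  field_simp

/-- Convexity plays no role: `v ≤ sinh v` and `cosh v ≤ 2` on `[0, 1]`, then monotonicity. After
taking logarithms this is the one-step recursion fed into `count_large_le`. -/
lemma half_min_le_tanh {u : ℝ} (hu : 0 ≤ u) : min u 1 / 2 ≤ Real.tanh u := by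
  have key : ∀ v : ℝ, 0 ≤ v → v ≤ 1 → v / 2 ≤ Real.tanh v := by
    intro v hv hv1
    rw [Real.tanh_eq_sinh_div_cosh, div_le_div_iff₀ (by norm_num) (Real.cosh_pos v)]
    have h1 : v ≤ Real.sinh v := Real.self_le_sinh_iff.2 hv
    have h2 : Real.cosh v ≤ 2 := by
      have h3 : Real.cosh v ≤ Real.cosh 1 := by
        rw [Real.cosh_le_cosh, abs_of_nonneg hv, abs_one]; exact hv1
      have h4 : Real.cosh 1 ≤ 2 := by
        rw [Real.cosh_eq]
        have h5 := Real.exp_one_lt_d9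
        have h6 : Real.exp (-1) ≤ 1 := Real.exp_le_one_iff.2 (by norm_num)
        linarith
      linarith
    have := mul_le_mul h1 h2 (Real.cosh_pos v).le (hv.trans h1)
    linarith
  rcases le_total u 1 with h | h
  · rw [min_eq_left h]; exact key u hu h
  · rw [min_eq_right h]; exact (key 1 zero_le_one le_rfl).trans (tanh_mono h)

lemma hasDerivAt_tanh (x : ℝ) : HasDerivAt Real.tanh (1 / Real.cosh x ^ 2) x := by
  have h : Real.tanh = fun x => Real.sinh x / Real.cosh x := by
    funext x; exact Real.tanh_eq_sinh_div_cosh x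
  rw [h]
  have h2 := (Real.hasDerivAt_sinh x).div (Real.hasDerivAt_cosh x) (Real.cosh_pos x).ne'
  refine HasDerivAt.congr_deriv h2 ?_
  rw [← Real.cosh_sq_sub_sinh_sq x]; ring

lemma abs_tanh_sub_le {M C : ℝ} (hC : ∀ x, M ≤ x → 1 / Real.cosh x ^ 2 ≤ C) {u v : ℝ}
    (hu : M ≤ u) (hv : M ≤ v) : |Real.tanh u - Real.tanh v| ≤ C * |u - v| := by
  have h := Convex.norm_image_sub_le_of_norm_hasDerivWithin_le (f := Real.tanh)
    (f' := fun x => 1 / Real.cosh x ^ 2) (s := Set.Ici M) (C := C) (x := v) (y := u)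
    (fun x _ => (hasDerivAt_tanh x).hasDerivWithinAt)
    (fun x hx => by
      rw [Real.norm_eq_abs, abs_of_nonneg (by positivity)]
      exact hC x hx) (convex_Ici M) hv hu
  simpa only [Real.norm_eq_abs] using h

lemma abs_tanh_sub_le_abs {u v : ℝ} (hu : 0 ≤ u) (hv : 0 ≤ v) :
    |Real.tanh u - Real.tanh v| ≤ |u - v| := by
  have h := abs_tanh_sub_le (M := 0) (C := 1) (fun x _ => by
    rw [div_le_one (by positivity)]
    nlinarith [Real.one_le_cosh x]) hu hv
  rwa [one_mul] at h

/-- The cubic term of the exponential suffices. With `κ = b ^ 64` it says that `tanh` has derivative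
at most `κ⁻²` beyond `b ^ 32`. -/
lemma pow_le_cosh {b x : ℝ} (hb : 2 ≤ b) (hx : b ^ 32 ≤ x) : b ^ 64 ≤ Real.cosh x := by
  have hx0 : 0 ≤ x := le_trans (by positivity) hx
  have h1 := Real.pow_div_factorial_le_exp x hx0 3
  have h2 : Real.exp x / 2 ≤ Real.cosh x := by
    rw [Real.cosh_eq]
    have := Real.exp_pos (-x)
    linarith
  have h3 : (b ^ 32) ^ 3 ≤ x ^ 3 := by gcongr
  have h4 : (12 : ℝ) ≤ b ^ 32 := by
    calc (12 : ℝ) ≤ 2 ^ 32 := by norm_num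
      _ ≤ b ^ 32 := by gcongr
  have h5 : 12 * b ^ 64 ≤ (b ^ 32) ^ 3 := by
    calc 12 * b ^ 64 ≤ b ^ 32 * b ^ 64 := by gcongr
      _ = (b ^ 32) ^ 3 := by ring
  norm_num [Nat.factorial] at h1
  linarith

/-! ### The torus -/

section TorusFacts

variable {D : ℕ}

lemma dist_apply_le (θ η : Torus D) (i : Fin D) : dist (θ i) (η i) ≤ dist θ η := by
  have h := (PiLp.lipschitzWith_ofLp 2 (fun _ : Fin D => UnitAddCircle)).dist_le_mul θ η
  refine (dist_le_pi_dist (WithLp.ofLp θ) (WithLp.ofLp η) i).trans ?_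
  simpa using h

lemma dist_le_sum (θ η : Torus D) : dist θ η ≤ ∑ i, dist (θ i) (η i) := by
  rw [PiLp.dist_eq_of_L2]
  rw [Real.sqrt_le_left (Finset.sum_nonneg fun _ _ => dist_nonneg)]
  exact Finset.sum_sq_le_sq_sum_of_nonneg fun _ _ => dist_nonneg

/-- The average `(1/D) ∑ sin (π θ_i)` multiplying the hyperbolic tangent. -/
noncomputable def avgSin (θ : Torus D) : ℝ := (1 / (D : ℝ)) * ∑ i, sinPi (θ i)

lemma avgSin_nonneg (θ : Torus D) : 0 ≤ avgSin θ := (avg_mem θ).1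

lemma avgSin_le_one (θ : Torus D) : avgSin θ ≤ 1 := (avg_mem θ).2

lemma abs_avgSin_sub_le (θ η : Torus D) : |avgSin θ - avgSin η| ≤ Real.pi * dist θ η := by
  rcases Nat.eq_zero_or_pos D with rfl | hD
  · simp [avgSin]
    positivity
  have hD' : (0 : ℝ) < D := by exact_mod_cast hD
  rw [avgSin, avgSin, ← mul_sub, ← Finset.sum_sub_distrib, abs_mul, abs_of_pos (by positivity),
    one_div, inv_mul_le_iff₀ hD']
  calc |∑ i, (sinPi (θ i) - sinPi (η i))| ≤ ∑ i, |sinPi (θ i) - sinPi (η i)| :=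
        Finset.abs_sum_le_sum_abs _ _
    _ ≤ ∑ _i : Fin D, Real.pi * dist θ η := Finset.sum_le_sum fun i _ =>
        (abs_sinPi_sub_le _ _).trans
          (mul_le_mul_of_nonneg_left (dist_apply_le θ η i) Real.pi_pos.le)
    _ = D * (Real.pi * dist θ η) := by simp

/-- The driving term is small only near 0, at a linear rate; this turns smallness of the driving
term into a close return of the rotation. -/
lemma norm_div_le_avgSin (θ : Torus D) : ‖θ‖ / D ≤ avgSin θ := by
  rw [avgSin, div_eq_inv_mul, one_div]
  gcongr
  have h := dist_le_sum θ 0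
  rw [dist_zero_right] at h
  refine h.trans (Finset.sum_le_sum fun i _ => ?_)
  have h2 := two_mul_norm_le_sinPi (θ i)
  have h3 : dist (θ i) ((0 : Torus D) i) = ‖θ i‖ := by simp
  rw [h3]
  linarith [norm_nonneg (θ i)]

lemma avgSin_zero : avgSin (0 : Torus D) = 0 := by
  have h : sinPi 0 = 0 := by
    have := sinPi_coe 0
    simpa using this
  simp [avgSin, h]

lemma iterate_rot (ρ : Fin D → ℝ) (n : ℕ) (θ : Torus D) :
    (rot ρ)^[n] θ = θ + n • toTorus ρ := by
  induction n with
  | zero => simp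
  | succ n ih => rw [Function.iterate_succ_apply', ih, rot, succ_nsmul, add_assoc]

lemma IsDiophantine.le_norm {c d : ℝ} {ρ : Fin D → ℝ} (h : IsDiophantine c d ρ) {n : ℕ}
    (hn : 1 ≤ n) : c * (n : ℝ) ^ (-d) ≤ ‖n • toTorus ρ‖ := by
  have := h n hn
  rwa [iterate_rot, zero_add, dist_zero_right] at this

lemma leb_preimage_pi {s : Fin D → Set UnitAddCircle} (hs : ∀ i, MeasurableSet (s i)) :
    leb D {θ | ∀ i, θ i ∈ s i} = ∏ i, volume (s i) := by
  have hset : {θ : Torus D | ∀ i, θ i ∈ s i} = WithLp.ofLp ⁻¹' (Set.univ.pi s) := by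
    ext θ; simp
  have hm : MeasurableSet (Set.univ.pi s) := MeasurableSet.univ_pi hs
  rw [leb, hset, Measure.map_apply (WithLp.measurable_toLp 2 _)
    (WithLp.measurable_ofLp 2 _ hm), ← preimage_comp]
  rw [show (WithLp.ofLp ∘ WithLp.toLp 2 : (Fin D → UnitAddCircle) → _) = id from rfl, preimage_id,
    volume_pi_pi]

instance : IsProbabilityMeasure (leb D) := by
  constructor
  have h := leb_preimage_pi (D := D) (s := fun _ => univ) fun _ => MeasurableSet.univ
  simpa using h

lemma leb_closedBall_le (θ : Torus D) (t : ℝ) :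
    leb D (Metric.closedBall θ t) ≤ ENNReal.ofReal (2 * t) ^ D := by
  calc leb D (Metric.closedBall θ t)
      ≤ leb D {η | ∀ i, η i ∈ Metric.closedBall (θ i) t} :=
        measure_mono fun η hη i => (dist_apply_le η θ i).trans hη
    _ = ∏ i : Fin D, volume (Metric.closedBall (θ i) t) :=
        leb_preimage_pi fun _ => Metric.isClosed_closedBall.measurableSet
    _ ≤ ∏ _i : Fin D, ENNReal.ofReal (2 * t) := by
        refine Finset.prod_le_prod' fun i _ => ?_
        rw [AddCircle.volume_closedBall]
        exact ENNReal.ofReal_le_ofReal (min_le_right _ _)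
    _ = ENNReal.ofReal (2 * t) ^ D := by simp

lemma leb_ball_le (θ : Torus D) (t : ℝ) :
    leb D (Metric.ball θ t) ≤ ENNReal.ofReal (2 * t) ^ D :=
  (measure_mono Metric.ball_subset_closedBall).trans (leb_closedBall_le θ t)

/-- The ball contains a cube of side `t / D`: by the `ℓ¹` bound its points are within `t / 2` of the
centre. -/
lemma le_leb_ball (hD : 1 ≤ D) (θ : Torus D) {t : ℝ} (ht : 0 < t) (ht1 : t ≤ 1) :
    ENNReal.ofReal (t / D) ^ D ≤ leb D (Metric.ball θ t) := by
  have hD' : (1 : ℝ) ≤ D := by exact_mod_cast hD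
  calc ENNReal.ofReal (t / D) ^ D
      = ∏ i : Fin D, volume (Metric.closedBall (θ i) (t / (2 * D))) := by
        simp_rw [AddCircle.volume_closedBall]
        have h1 : 2 * (t / (2 * D)) = t / D := by field_simp
        have h2 : t / D ≤ 1 := div_le_one_of_le₀ (by linarith) (by linarith)
        simp [h1, min_eq_right h2]
    _ = leb D {η | ∀ i, η i ∈ Metric.closedBall (θ i) (t / (2 * D))} :=
        (leb_preimage_pi fun _ => Metric.isClosed_closedBall.measurableSet).symm
    _ ≤ leb D (Metric.ball θ t) := by
        refine measure_mono fun η hη => ?_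
        have h3 : dist η θ ≤ ∑ _i : Fin D, t / (2 * D) :=
          (dist_le_sum η θ).trans (Finset.sum_le_sum fun i _ => hη i)
        have h4 : ∑ _i : Fin D, t / (2 * D) = t / 2 := by
          simp; field_simp
        rw [Metric.mem_ball]
        linarith

end TorusFacts

/-! ### The iterated upper bounding lines away from the singular orbit -/

/-- Points whose distance to `i ρ` is at least `b^{-(i+j)}` for `1 ≤ i ≤ n`. -/
def regularUpTo {D : ℕ} (ρ : Fin D → ℝ) (b : ℝ) (j n : ℕ) : Set (Torus D) :=
  {θ | ∀ i, 1 ≤ i → i ≤ n → b⁻¹ ^ (i + j) ≤ dist θ (i • toTorus ρ)}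

/-- Points whose distance to `i ρ` is at least `b^{-(i+j)}` for all `i ≥ 1`. -/
def regular {D : ℕ} (ρ : Fin D → ℝ) (b : ℝ) (j : ℕ) : Set (Torus D) :=
  {θ | ∀ i, 1 ≤ i → b⁻¹ ^ (i + j) ≤ dist θ (i • toTorus ρ)}

/-- The parameter `κ = b ^ 64` is large compared with the dimension and the Diophantine constants. -/
structure IsSteep (D : ℕ) (c d κ b : ℝ) : Prop where
  one_le_dim : 1 ≤ D
  c_pos : 0 < c
  d_pos : 0 < d
  pow_eq : b ^ 64 = κ
  dim_le : 16 * D + 2 ^ (D + 1) ≤ b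
  log_ge : (2 * D / c) ^ (1 / d) / (1 - Real.exp (-(1 / d))) + 1 ≤ Real.log b

section Dynamics

variable {D : ℕ} {ρ : Fin D → ℝ} {c d κ b : ℝ} {hκ : 0 < κ}

lemma regular_subset_regularUpTo (j n : ℕ) : regular ρ b j ⊆ regularUpTo ρ b j n :=
  fun _ hθ i hi _ => hθ i hi

namespace IsSteep

lemma one_le_log (hS : IsSteep D c d κ b) : 1 ≤ Real.log b := by
  have h := hS.log_ge
  have hd := hS.d_pos
  have hc := hS.c_pos
  have h1 : 0 < 1 - Real.exp (-(1 / d)) := by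
    have : Real.exp (-(1 / d)) < 1 := Real.exp_lt_one_iff.2 (neg_neg_of_pos (by positivity))
    linarith
  have h2 : 0 ≤ (2 * D / c) ^ (1 / d) / (1 - Real.exp (-(1 / d))) := by positivity
  linarith

lemma ge_twenty (hS : IsSteep D c d κ b) : 20 ≤ b := by
  have h1 : (1 : ℝ) ≤ D := by exact_mod_cast hS.one_le_dim
  have h2 : (2 : ℝ) ^ 2 ≤ 2 ^ (D + 1) := pow_le_pow_right₀ (by norm_num) (by
    have := hS.one_le_dim; omega)
  linarith [hS.dim_le]

lemma pos (hS : IsSteep D c d κ b) : 0 < b := by linarith [hS.ge_twenty]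

lemma one_le (hS : IsSteep D c d κ b) : 1 ≤ b := by linarith [hS.ge_twenty]

lemma sixteen_mul_dim_le (hS : IsSteep D c d κ b) : 16 * D ≤ b := by
  have : (0 : ℝ) < 2 ^ (D + 1) := by positivity
  linarith [hS.dim_le]

lemma two_pow_le (hS : IsSteep D c d κ b) : (2 : ℝ) ^ (D + 1) ≤ b := by
  have : (0 : ℝ) ≤ D := by positivity
  linarith [hS.dim_le]

lemma dim_pos (hS : IsSteep D c d κ b) : (0 : ℝ) < D := by exact_mod_cast hS.one_le_dim

lemma log_eq (hS : IsSteep D c d κ b) : Real.log κ = 64 * Real.log b := by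
  rw [← hS.pow_eq, Real.log_pow]; norm_num

end IsSteep

/-! ### Logarithms of the driving term along backward orbits -/

lemma avgSin_ge_of_mem (hS : IsSteep D c d κ b) {θ : Torus D} {j n i : ℕ}
    (h : θ ∈ regularUpTo ρ b j n) (hi : 1 ≤ i) (hin : i ≤ n) :
    b⁻¹ ^ (i + j) / D ≤ avgSin (θ - i • toTorus ρ) := by
  refine le_trans ?_ (norm_div_le_avgSin _)
  have hD := hS.dim_pos
  gcongr
  have := h i hi hin
  rwa [dist_eq_norm] at this

lemma avgSin_pos_of_mem (hS : IsSteep D c d κ b) {θ : Torus D} {j n i : ℕ}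
    (h : θ ∈ regularUpTo ρ b j n) (hi : 1 ≤ i) (hin : i ≤ n) :
    0 < avgSin (θ - i • toTorus ρ) := by
  refine lt_of_lt_of_le ?_ (avgSin_ge_of_mem hS h hi hin)
  have hD := hS.dim_pos
  have := hS.pos
  positivity

lemma neg_log_avgSin_le (hS : IsSteep D c d κ b) {θ : Torus D} {j n i : ℕ}
    (h : θ ∈ regularUpTo ρ b j n) (hi : 1 ≤ i) (hin : i ≤ n) :
    -Real.log (avgSin (θ - i • toTorus ρ)) ≤ (i + j + 1) * Real.log b := by
  have hD := hS.dim_pos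
  have hb := hS.pos
  have h1 := Real.log_le_log (by positivity) (avgSin_ge_of_mem hS h hi hin)
  rw [Real.log_div (by positivity) hD.ne', Real.log_pow, Real.log_inv] at h1
  have h2 : Real.log D ≤ Real.log b :=
    Real.log_le_log hD (by linarith [hS.sixteen_mul_dim_le])
  push_cast at h1
  linarith

/-- Birkhoff sums of `-log` of the driving term grow at most linearly, up to the largest term. -/
lemma sum_neg_log_avgSin_le (hS : IsSteep D c d κ b) (hρ : IsDiophantine c d ρ) {θ : Torus D}
    {j n s : ℕ} (h : θ ∈ regularUpTo ρ b j n) (hsn : s ≤ n) :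
    ∑ i ∈ Finset.range s, (Real.log 2 + -Real.log (avgSin (θ - (i + 1) • toTorus ρ))) ≤
      (2 * s + j + 2) * Real.log b := by
  have hD := hS.dim_pos
  have hc := hS.c_pos
  have hd := hS.d_pos
  have hl := hS.one_le_log
  have hq1 : Real.exp (-(1 / d)) < 1 := Real.exp_lt_one_iff.2 (neg_neg_of_pos (by positivity))
  -- Level `m` means distance below `D * exp (-m)` from 0, so two such times `s' < t` satisfy `c *
  -- (t - s') ^ (-d) < 2 * D * exp (-m)`; solving for `t - s'` gives `B` and `q`. The largest term
  -- `Ψ` comes from regularity of `θ`.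
  have key := sum_le_of_separated (N := s)
    (ψ := fun i => -Real.log (avgSin (θ - (i + 1) • toTorus ρ))) (B := (2 * D / c) ^ (1 / d))
    (q := Real.exp (-(1 / d))) (Ψ := (s + j + 1) * Real.log b) (by positivity) (Real.exp_pos _)
    hq1 (fun t ht => by
      refine (neg_log_avgSin_le hS h (by omega) (by omega)).trans ?_
      have : ((t + 1 : ℕ) : ℝ) ≤ s := by exact_mod_cast ht
      gcongr) (by positivity) ?_
  · rw [Finset.sum_add_distrib, Finset.sum_const, Finset.card_range, nsmul_eq_mul]
    have h1 := hS.log_ge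
    have h2 : Real.log 2 ≤ 1 := by linarith [Real.log_two_lt_d9]
    have h3 : (s : ℝ) * ((2 * D / c) ^ (1 / d) / (1 - Real.exp (-(1 / d))) + 1) ≤
        s * Real.log b := by gcongr
    have h4 : (s : ℝ) * Real.log 2 ≤ s := by
      have : (0 : ℝ) ≤ s := by positivity
      nlinarith
    linarith
  · intro m s' t hst hts hs' ht'
    have hlow : ∀ i < s, (m : ℝ) < -Real.log (avgSin (θ - (i + 1) • toTorus ρ)) →
        ‖θ - (i + 1) • toTorus ρ‖ < D * Real.exp (-m) := by
      intro i hi hm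
      have h1 := avgSin_pos_of_mem hS h (i := i + 1) (by omega) (by omega)
      have h2 : avgSin (θ - (i + 1) • toTorus ρ) < Real.exp (-m) := by
        rw [← Real.log_lt_iff_lt_exp h1]; linarith
      have h3 := norm_div_le_avgSin (θ - (i + 1) • toTorus ρ)
      rw [div_le_iff₀ hD] at h3
      nlinarith
    have h1 := hlow s' (by omega) hs'
    have h2 := hlow t hts ht'
    have hts' : ((t - s' : ℕ) : ℝ) = t - s' := Nat.cast_sub hst.le
    have hpos : (0 : ℝ) < t - s' := by rw [← hts']; exact_mod_cast Nat.sub_pos_of_lt hst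
    have h3 := hρ.le_norm (n := t - s') (by omega)
    have h4 : (t - s') • toTorus ρ =
        (θ - (s' + 1) • toTorus ρ) - (θ - (t + 1) • toTorus ρ) := by
      obtain ⟨m', rfl⟩ := Nat.exists_eq_add_of_lt hst
      rw [show s' + m' + 1 - s' = m' + 1 by omega,
        show s' + m' + 1 + 1 = (m' + 1) + (s' + 1) by ring, add_smul (m' + 1)]
      abel
    rw [h4, hts'] at h3
    have h5 : c * (t - s' : ℝ) ^ (-d) < 2 * D * Real.exp (-m) := by
      linarith [norm_sub_le (θ - (s' + 1) • toTorus ρ) (θ - (t + 1) • toTorus ρ)]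
    have h6 : (t - s' : ℝ) ^ (-d) < 2 * D / c * Real.exp (-m) := by
      rw [div_mul_eq_mul_div, lt_div_iff₀ hc]; linarith
    have h7 : ((t - s' : ℝ) ^ (-d)) ^ (1 / d) ≤ (2 * D / c * Real.exp (-m)) ^ (1 / d) := by
      gcongr
    rw [← Real.rpow_mul hpos.le, Real.mul_rpow (by positivity) (Real.exp_pos _).le,
      ← Real.exp_mul, show -d * (1 / d) = -1 by field_simp, Real.rpow_neg_one] at h7
    rw [show -(m : ℝ) * (1 / d) = m * -(1 / d) by ring, Real.exp_nat_mul] at h7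
    exact inv_le_of_inv_le₀ hpos h7

/-! ### Backward orbits of the upper lines and their contraction -/

lemma coe_upperLine_succ (n : ℕ) (θ : Torus D) :
    (upperLine ρ κ hκ (n + 1) θ : ℝ) =
      Real.tanh (κ * upperLine ρ κ hκ n (θ - toTorus ρ)) * avgSin (θ - toTorus ρ) := by
  rw [upperLine_succ]; rfl

/-- The value of the upper bounding line at the `i`-th backward iterate of `θ`. -/
noncomputable def backwardLine (ρ : Fin D → ℝ) (κ : ℝ) (hκ : 0 < κ) (n : ℕ) (θ : Torus D)
    (i : ℕ) : ℝ :=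
  upperLine ρ κ hκ (n - i) (θ - i • toTorus ρ)

lemma backwardLine_mem (n i : ℕ) (θ : Torus D) :
    backwardLine ρ κ hκ n θ i ∈ Set.Icc (0 : ℝ) 1 :=
  (upperLine ρ κ hκ (n - i) (θ - i • toTorus ρ)).2

lemma backwardLine_eq {n i : ℕ} (hi : i < n) (θ : Torus D) :
    backwardLine ρ κ hκ n θ i =
      Real.tanh (κ * backwardLine ρ κ hκ n θ (i + 1)) * avgSin (θ - (i + 1) • toTorus ρ) := by
  obtain ⟨m, rfl⟩ := Nat.exists_eq_add_of_lt hi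
  rw [backwardLine, backwardLine, show i + m + 1 - i = m + 1 by omega,
    show i + m + 1 - (i + 1) = m by omega, coe_upperLine_succ]
  rw [add_smul i 1, one_smul, sub_add_eq_sub_sub]

lemma backwardLine_self (n : ℕ) (θ : Torus D) : backwardLine ρ κ hκ n θ n = 1 := by
  simp [backwardLine, upperLine]

lemma backwardLine_zero (n : ℕ) (θ : Torus D) :
    backwardLine ρ κ hκ n θ 0 = upperLine ρ κ hκ n θ := by
  simp [backwardLine]

lemma tanh_pos {x : ℝ} (hx : 0 < x) : 0 < Real.tanh x := by
  rw [Real.tanh_eq_sinh_div_cosh]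
  exact div_pos (Real.sinh_pos_iff.2 hx) (Real.cosh_pos x)

lemma backwardLine_pos (hS : IsSteep D c d κ b) {θ : Torus D} {j n : ℕ}
    (h : θ ∈ regularUpTo ρ b j n) {i : ℕ} (hi : i ≤ n) : 0 < backwardLine ρ κ hκ n θ i := by
  induction hi using Nat.decreasingInduction with
  | self => rw [backwardLine_self]; exact one_pos
  | of_succ i hi ih =>
    rw [backwardLine_eq hi]
    exact mul_pos (tanh_pos (mul_pos hκ ih)) (avgSin_pos_of_mem hS h (by omega) (by omega))

/-- The indices `i < k` for which the line at the `(i+1)`-st backward iterate is below `b^{-32}`. -/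
noncomputable def lowIndices (ρ : Fin D → ℝ) (κ : ℝ) (hκ : 0 < κ) (b : ℝ) (n : ℕ) (θ : Torus D)
    (k : ℕ) : Finset ℕ :=
  (Finset.range k).filter fun i => 32 * Real.log b < -Real.log (backwardLine ρ κ hκ n θ (i + 1))

/-- A combination of `count_large_le`, with `L = 32 log b` equal to half of `log κ`, and the linear
bound for the accumulated costs. It bounds at once the depth of the line at `θ` and the number of
low indices. -/
lemma neg_log_add_card_le (hS : IsSteep D c d κ b) (hρ : IsDiophantine c d ρ) {θ : Torus D}
    {j n k : ℕ} (h : θ ∈ regularUpTo ρ b j n) (hkn : k ≤ n) :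
    -Real.log (upperLine ρ κ hκ n θ) +
      32 * Real.log b * (lowIndices ρ κ hκ b n θ k).card ≤ (66 + 2 * k + j) * Real.log b := by
  have hl := hS.one_le_log
  have hb := hS.pos
  obtain ⟨s, hks, hsn, hs⟩ := count_large_le
    (w := fun i => -Real.log (backwardLine ρ κ hκ n θ i))
    (e := fun i => Real.log 2 + -Real.log (avgSin (θ - (i + 1) • toTorus ρ)))
    (L := 32 * Real.log b) (by positivity) hkn
    (fun i => neg_nonneg.2 (Real.log_nonpos (backwardLine_mem n i θ).1 (backwardLine_mem n i θ).2))
    (by simp [backwardLine_self]) (fun i hi => by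
      have h1 := backwardLine_pos (hκ := hκ) hS h (i := i + 1) hi
      have h2 := avgSin_pos_of_mem hS h (i := i + 1) (by omega) hi
      have h3 : 0 < κ * backwardLine ρ κ hκ n θ (i + 1) := mul_pos hκ h1
      have h4 := half_min_le_tanh h3.le
      have h5 : 0 < min (κ * backwardLine ρ κ hκ n θ (i + 1)) 1 := lt_min h3 one_pos
      rw [backwardLine_eq hi, Real.log_mul (tanh_pos h3).ne' h2.ne']
      have h6 := Real.log_le_log (by positivity) h4
      rw [Real.log_div h5.ne' (by norm_num)] at h6
      have h7 : -Real.log (min (κ * backwardLine ρ κ hκ n θ (i + 1)) 1) ≤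
          max (-Real.log (backwardLine ρ κ hκ n θ (i + 1)) - 2 * (32 * Real.log b)) 0 := by
        rcases min_choice (κ * backwardLine ρ κ hκ n θ (i + 1)) 1 with h8 | h8
        · rw [h8, Real.log_mul hκ.ne' h1.ne', hS.log_eq]
          refine le_trans (le_of_eq ?_) (le_max_left _ _)
          ring
        · rw [h8]; simp
      linarith)
  have h2 := sum_neg_log_avgSin_le hS hρ h hsn
  have hks' : (k : ℝ) ≤ s := by exact_mod_cast hks
  simp only [backwardLine_zero] at hs
  rw [lowIndices]
  -- Starting at `s` instead of `k` costs `2 * (s - k) * log b` more, which the gain `32 * (s - k) *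
  -- log b` absorbs.
  nlinarith

lemma card_lowIndices_le (hS : IsSteep D c d κ b) (hρ : IsDiophantine c d ρ) {θ : Torus D}
    {j n k : ℕ} (h : θ ∈ regularUpTo ρ b j n) (hkn : k ≤ n) :
    32 * (lowIndices ρ κ hκ b n θ k).card ≤ 66 + 2 * k + j := by
  have hl := hS.one_le_log
  have h1 := neg_log_add_card_le (hκ := hκ) hS hρ h hkn
  have h2 : 0 ≤ -Real.log (upperLine ρ κ hκ n θ) :=
    neg_nonneg.2 (Real.log_nonpos (upperLine ρ κ hκ n θ).2.1 (upperLine ρ κ hκ n θ).2.2)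
  have h3 : (32 * (lowIndices ρ κ hκ b n θ k).card : ℝ) ≤ 66 + 2 * k + j := by
    refine le_of_mul_le_mul_right ?_ (lt_of_lt_of_le one_pos hl)
    linarith
  exact_mod_cast h3

lemma le_upperLine (hS : IsSteep D c d κ b) (hρ : IsDiophantine c d ρ) {θ : Torus D}
    {j n : ℕ} (h : θ ∈ regularUpTo ρ b j n) : b⁻¹ ^ (66 + j) ≤ upperLine ρ κ hκ n θ := by
  have hb := hS.pos
  have h1 := neg_log_add_card_le (hκ := hκ) hS hρ h (Nat.zero_le n)
  have h0 := backwardLine_pos (hκ := hκ) hS h (Nat.zero_le n)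
  rw [backwardLine_zero] at h0
  rw [← Real.log_le_log_iff (by positivity) h0, Real.log_pow, Real.log_inv]
  simp [lowIndices] at h1 ⊢
  linarith

/-- A bound for the contraction rate at the `i`-th backward step. -/
noncomputable def stepRate (ρ : Fin D → ℝ) (κ : ℝ) (hκ : 0 < κ) (b : ℝ) (n n' : ℕ)
    (θ θ' : Torus D) (i : ℕ) : ℝ :=
  κ⁻¹ *
    (if 32 * Real.log b < -Real.log (backwardLine ρ κ hκ n θ (i + 1)) then κ ^ 2 else 1) *
    (if 32 * Real.log b < -Real.log (backwardLine ρ κ hκ n' θ' (i + 1)) then κ ^ 2 else 1)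

lemma one_le_kappa (hS : IsSteep D c d κ b) : 1 ≤ κ := by
  rw [← hS.pow_eq]; exact one_le_pow₀ hS.one_le

/-- Split the difference of products: the driving term is `π`-Lipschitz and multiplied by at most 1,
while the difference of the `tanh` values is bounded by the mean value inequality. -/
lemma abs_backwardLine_sub_le (hS : IsSteep D c d κ b) {θ θ' : Torus D} {j n n' : ℕ}
    (h : θ ∈ regularUpTo ρ b j n) (h' : θ' ∈ regularUpTo ρ b j n') {i : ℕ} (hi : i < n)
    (hi' : i < n') :
    |backwardLine ρ κ hκ n θ i - backwardLine ρ κ hκ n' θ' i| ≤ Real.pi * dist θ θ' +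
      stepRate ρ κ hκ b n n' θ θ' i *
        |backwardLine ρ κ hκ n θ (i + 1) - backwardLine ρ κ hκ n' θ' (i + 1)| := by
  have hb := hS.pos
  have hκ1 := one_le_kappa hS
  rw [backwardLine_eq hi, backwardLine_eq hi', stepRate]
  have hx := backwardLine_pos (hκ := hκ) hS h (i := i + 1) hi
  have hx' := backwardLine_pos (hκ := hκ) hS h' (i := i + 1) hi'
  set x := backwardLine ρ κ hκ n θ (i + 1)
  set x' := backwardLine ρ κ hκ n' θ' (i + 1)
  set a := avgSin (θ - (i + 1) • toTorus ρ)
  set a' := avgSin (θ' - (i + 1) • toTorus ρ)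
  have ha : |a - a'| ≤ Real.pi * dist θ θ' := by
    have := abs_avgSin_sub_le (θ - (i + 1) • toTorus ρ) (θ' - (i + 1) • toTorus ρ)
    rwa [dist_sub_right] at this
  have hrate : |Real.tanh (κ * x) - Real.tanh (κ * x')| ≤ κ⁻¹ *
      (if 32 * Real.log b < -Real.log x then κ ^ 2 else 1) *
      (if 32 * Real.log b < -Real.log x' then κ ^ 2 else 1) * |x - x'| := by
    have hgen : |Real.tanh (κ * x) - Real.tanh (κ * x')| ≤ κ * |x - x'| := by
      refine (abs_tanh_sub_le_abs (by positivity) (by positivity)).trans (le_of_eq ?_)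
      rw [← mul_sub, abs_mul, abs_of_pos hκ]
    have h1 : κ⁻¹ * κ ^ 2 = κ := by field_simp
    -- As soon as one point is low the trivial rate `κ = κ⁻¹ * κ ^ 2` is used; with both low, `κ ^
    -- 3` is a harmless overestimate that keeps the rate a product over the two orbits.
    split_ifs with hc hc' hc'
    · refine hgen.trans (mul_le_mul_of_nonneg_right ?_ (abs_nonneg _))
      rw [h1]; nlinarith
    · rwa [h1, mul_one]
    · rwa [mul_one, h1]
    -- Neither point is low: both arguments of `tanh` are at least `κ * b ^ (-32) = b ^ 32`, so the
    -- rate is `κ * κ⁻² = κ⁻¹`.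
    · have hlow : ∀ y : ℝ, 0 < y → ¬ 32 * Real.log b < -Real.log y → b ^ 32 ≤ κ * y := by
        intro y hy hny
        rw [← Real.log_le_log_iff (by positivity) (by positivity), Real.log_mul hκ.ne' hy.ne',
          hS.log_eq, Real.log_pow]
        push_cast
        linarith
      have h2 := abs_tanh_sub_le (M := b ^ 32) (C := (κ ^ 2)⁻¹) (fun y hy => by
        rw [one_div]
        have := pow_le_cosh (by linarith [hS.ge_twenty]) hy
        rw [hS.pow_eq] at this
        gcongr) (hlow x hx hc) (hlow x' hx' hc')
      refine h2.trans (le_of_eq ?_)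
      rw [← mul_sub, abs_mul, abs_of_pos hκ]
      field_simp
  have ht : |Real.tanh (κ * x)| ≤ 1 := (Real.abs_tanh_lt_one _).le
  have ha0 : 0 ≤ a' := avgSin_nonneg _
  have ha1 : a' ≤ 1 := avgSin_le_one _
  calc |Real.tanh (κ * x) * a - Real.tanh (κ * x') * a'|
      = |Real.tanh (κ * x) * (a - a') + (Real.tanh (κ * x) - Real.tanh (κ * x')) * a'| := by
        congr 1; ring
    _ ≤ |Real.tanh (κ * x)| * |a - a'| + |Real.tanh (κ * x) - Real.tanh (κ * x')| * a' := by
        refine (abs_add_le _ _).trans (le_of_eq ?_)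
        rw [abs_mul, abs_mul, abs_of_nonneg ha0]
    _ ≤ 1 * |a - a'| + |Real.tanh (κ * x) - Real.tanh (κ * x')| * 1 := by gcongr
    _ ≤ _ := by rw [one_mul, mul_one]; exact add_le_add ha hrate

/-- Every step contributes `b ^ (-64)` and every low index costs `b ^ 128`, but each orbit has only
about `l / 16` low indices among the first `l`. -/
lemma prod_stepRate_le (hS : IsSteep D c d κ b) (hρ : IsDiophantine c d ρ) {θ θ' : Torus D}
    {j n n' l : ℕ} (h : θ ∈ regularUpTo ρ b j n) (h' : θ' ∈ regularUpTo ρ b j n') (hl : l ≤ n)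
    (hl' : l ≤ n') :
    ∏ i ∈ Finset.range l, stepRate ρ κ hκ b n n' θ θ' i ≤ b ^ (528 + 8 * j) * b⁻¹ ^ l := by
  have hb := hS.pos
  have hb1 := hS.one_le
  have h1 := card_lowIndices_le (hκ := hκ) hS hρ h hl
  have h2 := card_lowIndices_le (hκ := hκ) hS hρ h' hl'
  simp only [stepRate, Finset.prod_mul_distrib, Finset.prod_const, Finset.card_range,
    ← Finset.prod_filter]
  change κ⁻¹ ^ l * (κ ^ 2) ^ (lowIndices ρ κ hκ b n θ l).card *
    (κ ^ 2) ^ (lowIndices ρ κ hκ b n' θ' l).card ≤ _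
  generalize (lowIndices ρ κ hκ b n θ l).card = B at *
  generalize (lowIndices ρ κ hκ b n' θ' l).card = B' at *
  have hpow := hS.pow_eq
  calc κ⁻¹ ^ l * (κ ^ 2) ^ B * (κ ^ 2) ^ B'
      = b⁻¹ ^ (64 * l) * b ^ (128 * B + 128 * B') := by
        rw [← hpow, pow_add, ← inv_pow, ← pow_mul, ← pow_mul, ← pow_mul, ← pow_mul]
        ring
    -- The two counts give `2 * 128 / 32 * (66 + 2 * l + j) = 528 + 16 * l + 8 * j`. Allowing `63 *
    -- l` leaves one factor `b⁻¹` per step.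
    _ ≤ b⁻¹ ^ (64 * l) * b ^ (528 + 8 * j + 63 * l) := by
        refine mul_le_mul_of_nonneg_left (pow_le_pow_right₀ hb1 (by omega)) (by positivity)
    _ = b ^ (528 + 8 * j) * b⁻¹ ^ l * (b⁻¹ * b) ^ (63 * l) := by
        rw [pow_add b, mul_pow]; ring
    _ = _ := by rw [inv_mul_cancel₀ hb.ne', one_pow, mul_one]

/-- Lipschitz constants of the upper bounding graph on the regular sets. -/
def lipConst (b : ℝ) (j : ℕ) : ℝ := b ^ (529 + 8 * j)

/-- The one-step comparison is iterated `k` times and summed as a geometric series. The two lines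
may have different depths `n` and `n'`; their disagreement at time `k` costs only `b⁻¹ ^ k`. This
lets either depth tend to infinity. -/
lemma abs_upperLine_sub_le (hS : IsSteep D c d κ b) (hρ : IsDiophantine c d ρ) {θ θ' : Torus D}
    {j n n' k : ℕ} (h : θ ∈ regularUpTo ρ b j n) (h' : θ' ∈ regularUpTo ρ b j n') (hk : k ≤ n)
    (hk' : k ≤ n') :
    |(upperLine ρ κ hκ n θ : ℝ) - upperLine ρ κ hκ n' θ'| ≤
      lipConst b j * (dist θ θ' + b⁻¹ ^ k) := by
  have hb := hS.pos
  have hb20 := hS.ge_twenty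
  have key := le_sum_prod_of_step (k := k) (e := Real.pi * dist θ θ')
    (Δ := fun i => |backwardLine ρ κ hκ n θ i - backwardLine ρ κ hκ n' θ' i|)
    (ℓ := stepRate ρ κ hκ b n n' θ θ') (fun i => by rw [stepRate]; positivity)
    (fun i hi => abs_backwardLine_sub_le hS h h' (by omega) (by omega))
  simp only [backwardLine_zero] at key
  have hone : |backwardLine ρ κ hκ n θ k - backwardLine ρ κ hκ n' θ' k| ≤ 1 := by
    have h1 := backwardLine_mem (ρ := ρ) (hκ := hκ) n k θ
    have h2 := backwardLine_mem (ρ := ρ) (hκ := hκ) n' k θ'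
    rw [abs_le]
    constructor <;> linarith [h1.1, h1.2, h2.1, h2.2]
  have hsum : ∑ l ∈ Finset.range k, ∏ i ∈ Finset.range l, stepRate ρ κ hκ b n n' θ θ' i ≤
      b ^ (528 + 8 * j) * 2 := by
    calc _ ≤ ∑ l ∈ Finset.range k, b ^ (528 + 8 * j) * b⁻¹ ^ l :=
          Finset.sum_le_sum fun l hl => by
            have := Finset.mem_range.1 hl
            exact prod_stepRate_le hS hρ h h' (by omega) (by omega)
      _ = b ^ (528 + 8 * j) * ∑ l ∈ Finset.range k, b⁻¹ ^ l := (Finset.mul_sum _ _ _).symm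
      _ ≤ b ^ (528 + 8 * j) * 2 := by
          have hinv : b⁻¹ ≤ 1 / 2 := by
            rw [one_div]; gcongr; linarith
          have hle : ∑ l ∈ Finset.range k, b⁻¹ ^ l ≤ ∑ l ∈ Finset.range k, (1 / 2 : ℝ) ^ l := by
            gcongr
          gcongr
          exact hle.trans (sum_geometric_two_le k)
  have hprod := prod_stepRate_le (hκ := hκ) hS hρ h h' hk hk'
  have hpi : Real.pi * 2 ≤ b := by linarith [Real.pi_lt_four]
  have hpi0 := Real.pi_pos
  calc _ ≤ _ := key
    _ ≤ Real.pi * dist θ θ' * (b ^ (528 + 8 * j) * 2) + (b ^ (528 + 8 * j) * b⁻¹ ^ k) * 1 := by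
        gcongr
    _ = b ^ (528 + 8 * j) * ((Real.pi * 2) * dist θ θ' + 1 * b⁻¹ ^ k) := by ring
    _ ≤ b ^ (528 + 8 * j) * (b * dist θ θ' + b * b⁻¹ ^ k) := by
        gcongr
        linarith
    _ = lipConst b j * (dist θ θ' + b⁻¹ ^ k) := by rw [lipConst]; ring

/-! ### The upper bounding graph on the regular sets -/

lemma antitone_upperLine (θ : Torus D) : Antitone fun n => upperLine ρ κ hκ n θ := by
  have key : ∀ n, ∀ θ : Torus D, upperLine ρ κ hκ (n + 1) θ ≤ upperLine ρ κ hκ n θ := by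
    intro n
    induction n with
    | zero => intro θ; exact unitInterval.le_one'
    | succ n ih =>
      intro θ
      rw [upperLine_succ, upperLine_succ]
      exact monotone_fibreMap κ hκ _ (ih _)
  exact antitone_nat_of_succ_le fun n => key n θ

lemma tendsto_upperLine (θ : Torus D) :
    Tendsto (fun n => (upperLine ρ κ hκ n θ : ℝ)) atTop (𝓝 (phiPlus ρ κ hκ θ)) := by
  rw [phiPlus_eq_iInf]
  exact (continuous_subtype_val.tendsto _).comp (tendsto_atTop_iInf (antitone_upperLine θ))

lemma phiPlus_le_upperLine (n : ℕ) (θ : Torus D) :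
    (phiPlus ρ κ hκ θ : ℝ) ≤ upperLine ρ κ hκ n θ := by
  rw [phiPlus_eq_iInf]
  exact iInf_le (fun n => upperLine ρ κ hκ n θ) n

lemma abs_upperLine_sub_phiPlus_le (hS : IsSteep D c d κ b) (hρ : IsDiophantine c d ρ)
    {θ θ' : Torus D} {j m : ℕ} (h : θ ∈ regularUpTo ρ b j m) (h' : θ' ∈ regular ρ b j) :
    |(upperLine ρ κ hκ m θ : ℝ) - phiPlus ρ κ hκ θ'| ≤ lipConst b j * (dist θ θ' + b⁻¹ ^ m) := by
  have hlim := ((tendsto_const_nhds (x := (upperLine ρ κ hκ m θ : ℝ))).sub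
    (tendsto_upperLine (ρ := ρ) (hκ := hκ) θ')).abs
  refine le_of_tendsto hlim ?_
  filter_upwards [eventually_ge_atTop m] with n hn
  exact abs_upperLine_sub_le hS hρ h (regular_subset_regularUpTo j n h') le_rfl hn

lemma tendsto_inv_pow (hS : IsSteep D c d κ b) : Tendsto (fun m : ℕ => b⁻¹ ^ m) atTop (𝓝 0) :=
  tendsto_pow_atTop_nhds_zero_of_lt_one (inv_nonneg.2 hS.pos.le)
    (inv_lt_one_of_one_lt₀ (by linarith [hS.ge_twenty]))

lemma abs_phiPlus_sub_le (hS : IsSteep D c d κ b) (hρ : IsDiophantine c d ρ)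
    {θ θ' : Torus D} {j : ℕ} (h : θ ∈ regular ρ b j) (h' : θ' ∈ regular ρ b j) :
    |(phiPlus ρ κ hκ θ : ℝ) - phiPlus ρ κ hκ θ'| ≤ lipConst b j * dist θ θ' := by
  have h1 := ((tendsto_upperLine (ρ := ρ) (hκ := hκ) θ).sub_const
    (phiPlus ρ κ hκ θ' : ℝ)).abs
  have h2 := ((tendsto_inv_pow hS).const_add (dist θ θ')).const_mul (lipConst b j)
  rw [add_zero] at h2
  exact le_of_tendsto_of_tendsto' h1 h2 fun m =>
    abs_upperLine_sub_phiPlus_le hS hρ (regular_subset_regularUpTo j m h) h'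

lemma phiPlus_pos (hS : IsSteep D c d κ b) (hρ : IsDiophantine c d ρ) {θ : Torus D} {j : ℕ}
    (h : θ ∈ regular ρ b j) : 0 < (phiPlus ρ κ hκ θ : ℝ) := by
  have hb := hS.pos
  refine lt_of_lt_of_le (b := b⁻¹ ^ (66 + j)) (by positivity) ?_
  exact ge_of_tendsto' (tendsto_upperLine θ) fun n =>
    le_upperLine hS hρ (regular_subset_regularUpTo j n h)

/-- The fibre over 0 is pinched: the driving term vanishes there, and zero values are transported
forward since the fibre maps fix 0. -/
lemma upperLine_nsmul (n : ℕ) : upperLine ρ κ hκ (n + 1) ((n + 1) • toTorus ρ) = 0 := by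
  apply Subtype.ext
  induction n with
  | zero => rw [coe_upperLine_succ]; simp [avgSin_zero]
  | succ n ih =>
    rw [coe_upperLine_succ, show (n + 1 + 1) • toTorus ρ - toTorus ρ = (n + 1) • toTorus ρ by
      rw [succ_nsmul _ (n + 1), add_sub_cancel_right], ih]
    simp

lemma phiPlus_nsmul {n : ℕ} (hn : 1 ≤ n) : (phiPlus ρ κ hκ (n • toTorus ρ) : ℝ) = 0 := by
  obtain ⟨m, rfl⟩ := Nat.exists_eq_add_of_le' hn
  refine le_antisymm ((phiPlus_le_upperLine (m + 1) _).trans ?_) (phiPlus ρ κ hκ _).2.1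
  rw [upperLine_nsmul]; simp

end Dynamics

/-! ### The measure of the regular sets -/

section Measure

variable {D : ℕ} {ρ : Fin D → ℝ} {c d κ b : ℝ} {hκ : 0 < κ}

lemma isClosed_regular (j : ℕ) : IsClosed (regular ρ b j) := by
  simp only [regular, ofPred_forall]
  exact isClosed_iInter fun i => isClosed_iInter fun _ =>
    isClosed_le continuous_const (continuous_id.dist continuous_const)

namespace IsSteep

lemma inv_pos (hS : IsSteep D c d κ b) : 0 < b⁻¹ := _root_.inv_pos.2 hS.pos

lemma inv_le_one (hS : IsSteep D c d κ b) : b⁻¹ ≤ 1 := inv_le_one_of_one_le₀ hS.one_le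

lemma inv_le_one_twentieth (hS : IsSteep D c d κ b) : b⁻¹ ≤ 1 / 20 := by
  rw [one_div]
  exact inv_anti₀ (by norm_num) hS.ge_twenty

end IsSteep

lemma monotone_regular (hS : IsSteep D c d κ b) : Monotone (regular ρ b) := by
  intro j j' hj θ hθ i hi
  exact (pow_le_pow_of_le_one hS.inv_pos.le hS.inv_le_one (by omega)).trans (hθ i hi)

lemma compl_regular (j : ℕ) :
    (regular ρ b j)ᶜ = ⋃ i : ℕ, Metric.ball ((i + 1) • toTorus ρ) (b⁻¹ ^ (i + 1 + j)) := by
  ext θ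
  simp only [regular, mem_compl_iff, mem_ofPred_eq, not_forall, not_le, mem_iUnion,
    Metric.mem_ball, exists_prop]
  constructor
  · rintro ⟨i, hi, h⟩
    exact ⟨i - 1, by rwa [Nat.sub_add_cancel hi]⟩
  · rintro ⟨i, h⟩
    exact ⟨i + 1, by omega, h⟩

lemma leb_real_ball_le (θ : Torus D) {t : ℝ} (ht : 0 ≤ t) :
    (leb D).real (Metric.ball θ t) ≤ (2 * t) ^ D := by
  refine ENNReal.toReal_le_of_le_ofReal (by positivity) ((leb_ball_le θ t).trans (le_of_eq ?_))
  rw [ENNReal.ofReal_pow (by positivity)]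

lemma le_leb_real_ball (hD : 1 ≤ D) (θ : Torus D) {t : ℝ} (ht : 0 < t) (ht1 : t ≤ 1) :
    (t / D) ^ D ≤ (leb D).real (Metric.ball θ t) := by
  have h := le_leb_ball hD θ ht ht1
  rw [← ENNReal.ofReal_pow (by positivity)] at h
  exact (ENNReal.ofReal_le_iff_le_toReal (measure_ne_top _ _)).1 h

/-- The volumes decrease at least by the factor `r ≤ 1 / 2`, since `r ^ D ≤ r`; thus the total is at
most twice the first bound. -/
lemma leb_iUnion_ball_le (hD : 1 ≤ D) (x : ℕ → Torus D) {A r : ℝ} (hA : 0 ≤ A) (hr : 0 ≤ r)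
    (hr2 : r ≤ 1 / 2) :
    (leb D).real (⋃ l, Metric.ball (x l) (A * r ^ l)) ≤ 2 * (2 * A) ^ D := by
  refine ENNReal.toReal_le_of_le_ofReal (by positivity) ?_
  have hs : Summable fun l : ℕ => (2 * A) ^ D * r ^ l :=
    (summable_geometric_of_lt_one hr (by linarith)).mul_left _
  calc leb D (⋃ l, Metric.ball (x l) (A * r ^ l))
      ≤ ∑' l, leb D (Metric.ball (x l) (A * r ^ l)) := measure_iUnion_le _
    _ ≤ ∑' l : ℕ, ENNReal.ofReal ((2 * A) ^ D * r ^ l) := by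
        refine ENNReal.tsum_le_tsum fun l => (leb_ball_le _ _).trans ?_
        rw [← ENNReal.ofReal_pow (by positivity)]
        refine ENNReal.ofReal_le_ofReal ?_
        rw [← mul_assoc, mul_pow]
        gcongr
        exact pow_le_of_le_one (by positivity) (pow_le_one₀ hr (by linarith)) (by omega)
    _ = ENNReal.ofReal (∑' l : ℕ, (2 * A) ^ D * r ^ l) :=
        (ENNReal.ofReal_tsum_of_nonneg (fun l => by positivity) hs).symm
    _ ≤ ENNReal.ofReal (2 * (2 * A) ^ D) := by
        refine ENNReal.ofReal_le_ofReal ?_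
        rw [tsum_mul_left, tsum_geometric_of_lt_one hr (by linarith), mul_comm]
        gcongr
        rw [inv_le_comm₀ (by linarith) (by norm_num)]
        linarith

lemma leb_compl_regular_le (hS : IsSteep D c d κ b) (j : ℕ) :
    (leb D).real (regular ρ b j)ᶜ ≤ b⁻¹ ^ j := by
  have hr := hS.inv_pos
  have hr1 := hS.inv_le_one
  have hD := hS.one_le_dim
  have h := leb_iUnion_ball_le hD (fun i => (i + 1) • toTorus ρ) (A := b⁻¹ ^ (j + 1)) (r := b⁻¹)
    (by positivity) hr.le (by linarith [hS.inv_le_one_twentieth])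
  rw [compl_regular]
  have heq : ∀ i : ℕ, b⁻¹ ^ (i + 1 + j) = b⁻¹ ^ (j + 1) * b⁻¹ ^ i := fun i => by ring
  simp_rw [heq]
  refine h.trans ?_
  calc 2 * (2 * b⁻¹ ^ (j + 1)) ^ D = 2 ^ (D + 1) * (b⁻¹ ^ (j + 1)) ^ D := by
        rw [mul_pow]; ring
    _ ≤ b * b⁻¹ ^ (j + 1) := by
        gcongr
        · exact hS.pos.le
        · exact hS.two_pow_le
        · exact pow_le_of_le_one (by positivity) (pow_le_one₀ hr.le hr1) (by omega)
    _ = b⁻¹ ^ j := by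
        rw [pow_succ, mul_comm (b⁻¹ ^ j), ← mul_assoc, mul_inv_cancel₀ hS.pos.ne', one_mul]

lemma ae_exists_mem_regular (hS : IsSteep D c d κ b) : ∀ᵐ θ ∂(leb D), ∃ j, θ ∈ regular ρ b j := by
  have h0 : (leb D).real (⋂ j, (regular ρ b j)ᶜ) ≤ 0 := by
    refine ge_of_tendsto' (tendsto_inv_pow hS) fun j => ?_
    exact (measureReal_mono (iInter_subset _ j)).trans (leb_compl_regular_le hS j)
  have h1 : leb D (⋂ j, (regular ρ b j)ᶜ) = 0 := by
    have h2 := le_antisymm h0 measureReal_nonneg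
    rwa [measureReal_eq_zero_iff] at h2
  rw [ae_iff]
  convert h1 using 2
  ext θ
  simp

/-- A quantitative density property of the regular sets. -/
lemma le_leb_ball_inter_regular (hS : IsSteep D c d κ b) {θ : Torus D} {j : ℕ}
    (h : θ ∈ regular ρ b j) {t : ℝ} (ht : 0 < t) (ht1 : t ≤ 1) :
    (t / D) ^ D / 2 ≤ (leb D).real (Metric.ball θ t ∩ regular ρ b (j + 1)) := by
  have hr := hS.inv_pos
  have hr20 := hS.inv_le_one_twentieth
  have hD := hS.one_le_dim
  have hD' := hS.dim_pos
  have hdiff : (leb D).real (Metric.ball θ t \ regular ρ b (j + 1)) ≤ (t / D) ^ D / 2 := by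
    -- Excluded balls with index below the threshold `i₀` cannot meet `ball θ t`, because their
    -- centres are at distance at least `b⁻¹ ^ (i + j) ≥ 2 * t` from `θ` and level `j + 1` shrinks
    -- the radii by `b⁻¹ ≤ 1 / 20`. Those from `i₀` on have radii small compared with `t / D`.
    have hex : ∃ i : ℕ, b⁻¹ ^ (i + j) < 2 * t := by
      obtain ⟨i, hi⟩ := ((tendsto_inv_pow hS).eventually (gt_mem_nhds
        (show (0 : ℝ) < 2 * t by linarith))).exists
      exact ⟨i, (pow_le_pow_of_le_one hr.le hS.inv_le_one (by omega)).trans_lt hi⟩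
    classical
    obtain ⟨i₀, hi₀, hmin⟩ : ∃ i₀ : ℕ, b⁻¹ ^ (i₀ + j) < 2 * t ∧
        ∀ i < i₀, 2 * t ≤ b⁻¹ ^ (i + j) :=
      ⟨Nat.find hex, Nat.find_spec hex, fun i hi => not_lt.1 (Nat.find_min hex hi)⟩
    have hsub : Metric.ball θ t \ regular ρ b (j + 1) ⊆
        ⋃ l : ℕ, Metric.ball ((l + i₀) • toTorus ρ) (b⁻¹ ^ (i₀ + j + 1) * b⁻¹ ^ l) := by
      rintro η ⟨hη, hη'⟩
      simp only [regular, mem_ofPred_eq, not_forall, not_le, exists_prop] at hη'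
      obtain ⟨i, hi, hlt⟩ := hη'
      have h1 := h i hi
      have h2 : dist θ (i • toTorus ρ) ≤ dist η θ + dist η (i • toTorus ρ) :=
        dist_triangle_left _ _ _
      rw [Metric.mem_ball] at hη
      have hi' : i₀ ≤ i := by
        by_contra hcon
        have h3 := hmin i (not_le.1 hcon)
        have h4 : b⁻¹ ^ (i + (j + 1)) = b⁻¹ ^ (i + j) * b⁻¹ := by ring
        nlinarith
      refine mem_iUnion.2 ⟨i - i₀, ?_⟩
      rw [Nat.sub_add_cancel hi', Metric.mem_ball, ← pow_add]
      rwa [show i₀ + j + 1 + (i - i₀) = i + (j + 1) by omega]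
    refine (measureReal_mono hsub).trans ((leb_iUnion_ball_le hD _ (by positivity) hr.le
      (by linarith)).trans ?_)
    have h5 : 2 * b⁻¹ ^ (i₀ + j + 1) ≤ 1 / 4 * (t / D) := by
      have h6 : b⁻¹ * (16 * D) ≤ 1 := by
        rw [inv_mul_le_one₀ hS.pos]; exact hS.sixteen_mul_dim_le
      have h7 : b⁻¹ ^ (i₀ + j + 1) = b⁻¹ ^ (i₀ + j) * b⁻¹ := by ring
      rw [← mul_div_assoc, le_div_iff₀ hD', h7]
      have h8 : b⁻¹ ^ (i₀ + j) * (b⁻¹ * (16 * D)) ≤ (2 * t) * 1 := by gcongr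
      linarith
    calc 2 * (2 * b⁻¹ ^ (i₀ + j + 1)) ^ D ≤ 2 * (1 / 4 * (t / D)) ^ D := by gcongr
      _ = 2 * ((1 / 4) ^ D * (t / D) ^ D) := by rw [mul_pow]
      _ ≤ 2 * ((1 / 4) * (t / D) ^ D) := by
          gcongr
          exact pow_le_of_le_one (by norm_num) (by norm_num) (by omega)
      _ = (t / D) ^ D / 2 := by ring
  have h1 := le_leb_real_ball hD θ ht ht1
  have h2 := measureReal_inter_add_sdiff (μ := leb D) (s := Metric.ball θ t)
    (isClosed_regular (ρ := ρ) (b := b) (j + 1)).measurableSet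
  linarith

/-! ### The measure of balls centred on the graph -/

lemma measurable_graphMap : Measurable fun θ : Torus D => (θ, phiPlus ρ κ hκ θ) :=
  measurable_id.prodMk (measurable_phiPlus ρ κ hκ)

instance : IsProbabilityMeasure (muPlus ρ κ hκ) :=
  Measure.isProbabilityMeasure_map measurable_graphMap.aemeasurable

lemma muPlus_real_ball_le (p : Torus D × I) {ε : ℝ} (hε : 0 ≤ ε) :
    (muPlus ρ κ hκ).real (Metric.ball p ε) ≤ (2 * ε) ^ D := by
  rw [muPlus, map_measureReal_apply measurable_graphMap Metric.isOpen_ball.measurableSet]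
  refine (measureReal_mono ?_).trans (leb_real_ball_le p.1 hε)
  intro η hη
  rw [mem_preimage, Metric.mem_ball, Prod.dist_eq] at hη
  exact (le_max_left _ _).trans_lt hη

lemma one_le_lipConst (hS : IsSteep D c d κ b) (j : ℕ) : 1 ≤ lipConst b j :=
  one_le_pow₀ hS.one_le

/-- Points of `regular (j + 1)` within `ε / lipConst b (j + 1)` of `θ` lift into the ball of radius
`ε`, and the density property says there are enough of them. -/
lemma le_muPlus_real_ball (hS : IsSteep D c d κ b) (hρ : IsDiophantine c d ρ) {θ : Torus D}
    {j : ℕ} (h : θ ∈ regular ρ b j) {ε : ℝ} (hε : 0 < ε) (hε1 : ε ≤ 1) :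
    (ε / lipConst b (j + 1) / D) ^ D / 2 ≤
      (muPlus ρ κ hκ).real (Metric.ball (θ, phiPlus ρ κ hκ θ) ε) := by
  have hK := one_le_lipConst hS (j + 1)
  have hK0 : 0 < lipConst b (j + 1) := by linarith
  have hle : ε / lipConst b (j + 1) ≤ ε := div_le_self hε.le hK
  refine (le_leb_ball_inter_regular hS h (div_pos hε hK0) (hle.trans hε1)).trans ?_
  rw [muPlus, map_measureReal_apply measurable_graphMap Metric.isOpen_ball.measurableSet]
  refine measureReal_mono ?_
  rintro η ⟨hη, hη'⟩
  rw [Metric.mem_ball] at hη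
  have h1 := abs_phiPlus_sub_le (hκ := hκ) hS hρ hη' (monotone_regular hS (Nat.le_succ j) h)
  have h2 : lipConst b (j + 1) * dist η θ < ε := by
    rwa [lt_div_iff₀' hK0] at hη
  exact max_lt (hη.trans_le hle) (h1.trans_lt h2)

/-- The constant in the lower bound for the logarithm of the measure of balls. -/
noncomputable def logConst (D : ℕ) (b : ℝ) : ℝ := Real.log 2 + D * (Real.log D + 537 * Real.log b)

/-- The error must be linear in `j`: this makes it integrable in the information dimension. -/
lemma le_log_muPlus_ball (hS : IsSteep D c d κ b) (hρ : IsDiophantine c d ρ) {θ : Torus D}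
    {j : ℕ} (h : θ ∈ regular ρ b j) {ε : ℝ} (hε : 0 < ε) (hε1 : ε ≤ 1) :
    -(logConst D b + 8 * D * Real.log b * j) + D * Real.log ε ≤
      Real.log ((muPlus ρ κ hκ).real (Metric.ball (θ, phiPlus ρ κ hκ θ) ε)) := by
  have hD := hS.dim_pos
  have hb := hS.pos
  have hK0 : 0 < lipConst b (j + 1) := by linarith [one_le_lipConst hS (j + 1)]
  refine le_trans (le_of_eq ?_)
    (Real.log_le_log (by positivity) (le_muPlus_real_ball (hκ := hκ) hS hρ h hε hε1))
  rw [Real.log_div (by positivity) (by norm_num), Real.log_pow,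
    Real.log_div (by positivity) hD.ne', Real.log_div hε.ne' hK0.ne', lipConst, Real.log_pow,
    logConst]
  push_cast
  ring

/-! ### Pointwise and information dimension -/

lemma tendsto_div_log {g : ℝ → ℝ} {s C C' : ℝ}
    (hlow : ∀ ε, 0 < ε → ε ≤ 1 → -C + s * Real.log ε ≤ g ε)
    (hup : ∀ ε, 0 < ε → ε ≤ 1 → g ε ≤ C' + s * Real.log ε) :
    Tendsto (fun ε => g ε / Real.log ε) (𝓝[>] 0) (𝓝 s) := by
  have hlog : Tendsto (fun ε => (Real.log ε)⁻¹) (𝓝[>] 0) (𝓝 0) :=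
    Real.tendsto_log_nhdsGT_zero.inv_tendsto_atBot
  have h1 : Tendsto (fun ε => C' * (Real.log ε)⁻¹ + s) (𝓝[>] 0) (𝓝 s) := by
    simpa using (hlog.const_mul C').add_const s
  have h2 : Tendsto (fun ε => -C * (Real.log ε)⁻¹ + s) (𝓝[>] 0) (𝓝 s) := by
    simpa using (hlog.const_mul (-C)).add_const s
  have hmem : Ioo (0 : ℝ) 1 ∈ 𝓝[>] (0 : ℝ) := Ioo_mem_nhdsGT one_pos
  refine tendsto_of_tendsto_of_tendsto_of_le_of_le' h1 h2 ?_ ?_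
  · filter_upwards [hmem] with ε hε
    have hl : Real.log ε < 0 := Real.log_neg hε.1 hε.2
    rw [le_div_iff_of_neg hl, add_mul, mul_assoc, inv_mul_cancel₀ hl.ne, mul_one]
    exact hup ε hε.1 hε.2.le
  · filter_upwards [hmem] with ε hε
    have hl : Real.log ε < 0 := Real.log_neg hε.1 hε.2
    rw [div_le_iff_of_neg hl, add_mul, mul_assoc, inv_mul_cancel₀ hl.ne, mul_one]
    exact hlow ε hε.1 hε.2.le

lemma log_muPlus_ball_le {p : Torus D × I} {ε : ℝ} (hε : 0 < ε)
    (hpos : 0 < (muPlus ρ κ hκ).real (Metric.ball p ε)) :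
    Real.log ((muPlus ρ κ hκ).real (Metric.ball p ε)) ≤ D * Real.log 2 + D * Real.log ε := by
  have h := Real.log_le_log hpos (muPlus_real_ball_le p hε.le)
  rwa [Real.log_pow, Real.log_mul (by norm_num) hε.ne', mul_add] at h

lemma muPlus_real_ball_pos (hS : IsSteep D c d κ b) (hρ : IsDiophantine c d ρ) {θ : Torus D}
    {j : ℕ} (h : θ ∈ regular ρ b j) {ε : ℝ} (hε : 0 < ε) :
    0 < (muPlus ρ κ hκ).real (Metric.ball (θ, phiPlus ρ κ hκ θ) ε) := by
  have hD := hS.dim_pos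
  have hK0 : 0 < lipConst b (j + 1) := by linarith [one_le_lipConst hS (j + 1)]
  have hm : 0 < min ε 1 := lt_min hε one_pos
  refine lt_of_lt_of_le ?_ ((le_muPlus_real_ball (hκ := hκ) hS hρ h hm (min_le_right _ _)).trans
    (measureReal_mono (Metric.ball_subset_ball (min_le_left _ _))))
  positivity

lemma tendsto_coe_ereal {g : ℝ → ℝ} {s : ℕ} (h : Tendsto g (𝓝[>] 0) (𝓝 (s : ℝ))) :
    Tendsto (fun ε => (g ε : EReal)) (𝓝[>] 0) (𝓝 (s : EReal)) := by
  have h2 := (continuous_coe_real_ereal.tendsto (s : ℝ)).comp h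
  simpa [Function.comp_def] using h2

/-- The part of the graph of `φ⁺` over a set. -/
def graphOver (ρ : Fin D → ℝ) (κ : ℝ) (hκ : 0 < κ) (S : Set (Torus D)) : Set (Torus D × I) :=
  {p | p.1 ∈ S ∧ p.2 = phiPlus ρ κ hκ p.1}

lemma measurableSet_graphOver {S : Set (Torus D)} (hS : MeasurableSet S) :
    MeasurableSet (graphOver ρ κ hκ S) :=
  (measurable_fst hS).inter
    (measurableSet_eq_fun measurable_snd ((measurable_phiPlus ρ κ hκ).comp measurable_fst))

lemma graphPlus_eq_graphOver_univ : graphPlus ρ κ hκ = graphOver ρ κ hκ univ := by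
  ext p
  constructor
  · rintro ⟨θ, rfl⟩; exact ⟨mem_univ _, rfl⟩
  · intro hp; exact ⟨p.1, Prod.ext rfl hp.2.symm⟩

lemma graphOver_iUnion {ι : Sort*} (S : ι → Set (Torus D)) :
    graphOver ρ κ hκ (⋃ i, S i) = ⋃ i, graphOver ρ κ hκ (S i) := by
  ext p; simp [graphOver]

lemma graphOver_union (S T : Set (Torus D)) :
    graphOver ρ κ hκ (S ∪ T) = graphOver ρ κ hκ S ∪ graphOver ρ κ hκ T := by
  ext p; simp [graphOver, or_and_right]

lemma graphOver_mono {S T : Set (Torus D)} (h : S ⊆ T) :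
    graphOver ρ κ hκ S ⊆ graphOver ρ κ hκ T := fun _ hp => ⟨h hp.1, hp.2⟩

lemma ae_mem_graphOver (hS : IsSteep D c d κ b) :
    ∀ᵐ p ∂(muPlus ρ κ hκ), p ∈ graphOver ρ κ hκ (⋃ j, regular ρ b j) := by
  have hm : MeasurableSet (graphOver ρ κ hκ (⋃ j, regular ρ b j)) :=
    measurableSet_graphOver (MeasurableSet.iUnion fun j => (isClosed_regular j).measurableSet)
  refine (ae_map_iff measurable_graphMap.aemeasurable hm).2 ?_
  filter_upwards [ae_exists_mem_regular (ρ := ρ) hS] with θ hθ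
  exact ⟨mem_iUnion.2 hθ, rfl⟩

theorem isExactDimensional_muPlus (hS : IsSteep D c d κ b) (hρ : IsDiophantine c d ρ) :
    IsExactDimensional (muPlus ρ κ hκ) (D : EReal) := by
  have hmem : ∀ θ : Torus D, (∃ j, θ ∈ regular ρ b j) →
      HasPointwiseDim (muPlus ρ κ hκ) (θ, phiPlus ρ κ hκ θ) (D : EReal) := by
    rintro θ ⟨j, h⟩
    have ht := tendsto_coe_ereal (tendsto_div_log
      (g := fun ε => Real.log ((muPlus ρ κ hκ).real (Metric.ball (θ, phiPlus ρ κ hκ θ) ε)))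
      (fun ε h0 h1 => le_log_muPlus_ball (hκ := hκ) hS hρ h h0 h1)
      (fun ε h0 h1 => log_muPlus_ball_le h0 (muPlus_real_ball_pos hS hρ h h0)))
    refine ⟨?_, ht.liminf_eq, ht.limsup_eq⟩
    rw [Metric.nhds_basis_ball.mem_measureSupport]
    intro ε hε
    exact (ENNReal.toReal_pos_iff.1 (muPlus_real_ball_pos hS hρ h hε)).1
  filter_upwards [ae_mem_graphOver hS] with p hp
  obtain ⟨h1, h2⟩ := hp
  have hp' : p = (p.1, phiPlus ρ κ hκ p.1) := Prod.ext rfl h2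
  rw [hp']
  exact hmem p.1 (mem_iUnion.1 h1)

/-! ### Integrability of the regularity index and information dimension -/

lemma measurable_muPlus_real_ball (ε : ℝ) :
    Measurable fun p => (muPlus ρ κ hκ).real (Metric.ball p ε) := by
  have hopen : IsOpen {q : (Torus D × I) × (Torus D × I) | dist q.2 q.1 < ε} :=
    isOpen_lt (continuous_snd.dist continuous_fst) continuous_const
  have : OpensMeasurableSpace ((Torus D × I) × (Torus D × I)) := Prod.opensMeasurableSpace
  have h := measurable_measure_prodMk_left (ν := muPlus ρ κ hκ) hopen.measurableSet
  exact h.ennreal_toReal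

/-- The least index of a regular set containing `θ` (`∞` if there is none). -/
noncomputable def regularIndex (ρ : Fin D → ℝ) (b : ℝ) (θ : Torus D) : ℝ≥0∞ :=
  ∑' j, (regular ρ b j)ᶜ.indicator 1 θ

lemma measurable_regularIndex : Measurable (regularIndex ρ b) :=
  Measurable.tsum fun j =>
    measurable_one.indicator (isClosed_regular j).measurableSet.compl

lemma lintegral_regularIndex_ne_top (hS : IsSteep D c d κ b) :
    ∫⁻ θ, regularIndex ρ b θ ∂(leb D) ≠ ∞ := by
  have hr := hS.inv_pos
  have hs : Summable fun j : ℕ => b⁻¹ ^ j :=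
    summable_geometric_of_lt_one hr.le (by linarith [hS.inv_le_one_twentieth])
  have hm : ∀ j, MeasurableSet (regular ρ b j)ᶜ := fun j =>
    (isClosed_regular j).measurableSet.compl
  simp only [regularIndex]
  rw [lintegral_tsum fun j => (measurable_one.indicator (hm j)).aemeasurable]
  refine ne_top_of_le_ne_top (b := ENNReal.ofReal (∑' j : ℕ, b⁻¹ ^ j)) ENNReal.ofReal_ne_top ?_
  rw [ENNReal.ofReal_tsum_of_nonneg (fun j => by positivity) hs]
  refine ENNReal.tsum_le_tsum fun j => ?_
  rw [lintegral_indicator_one (hm j)]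
  rw [ENNReal.le_ofReal_iff_toReal_le (measure_ne_top _ _) (by positivity)]
  exact leb_compl_regular_le hS j

lemma exists_mem_regular_le_regularIndex {θ : Torus D}
    (h : ∃ j, θ ∈ regular ρ b j) (hfin : regularIndex ρ b θ ≠ ∞) :
    ∃ j : ℕ, θ ∈ regular ρ b j ∧ (j : ℝ) ≤ (regularIndex ρ b θ).toReal := by
  classical
  refine ⟨Nat.find h, Nat.find_spec h, ?_⟩
  rw [← ENNReal.ofReal_le_iff_le_toReal hfin, ENNReal.ofReal_natCast]
  -- All indices below the least one contribute 1 to the series.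
  refine le_trans (le_of_eq ?_) (ENNReal.sum_le_tsum (Finset.range (Nat.find h)))
  rw [Finset.sum_congr rfl fun i hi => indicator_of_mem (f := 1)
    (show θ ∈ (regular ρ b i)ᶜ from Nat.find_min h (Finset.mem_range.1 hi))]
  simp

theorem hasInformationDim_muPlus (hS : IsSteep D c d κ b) (hρ : IsDiophantine c d ρ) :
    HasInformationDim (muPlus ρ κ hκ) (D : EReal) := by
  have hl := hS.one_le_log
  have hD := hS.dim_pos
  set G : Torus D → ℝ := fun θ => (regularIndex ρ b θ).toReal with hG
  have hGint : Integrable G (leb D) :=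
    integrable_toReal_of_lintegral_ne_top measurable_regularIndex.aemeasurable
      (lintegral_regularIndex_ne_top hS)
  have hae : ∀ᵐ θ ∂(leb D), ∃ j : ℕ, θ ∈ regular ρ b j ∧ (j : ℝ) ≤ G θ := by
    filter_upwards [ae_exists_mem_regular (ρ := ρ) hS,
      ae_lt_top measurable_regularIndex (lintegral_regularIndex_ne_top (ρ := ρ) hS)] with θ h1 h2
    exact exists_mem_regular_le_regularIndex h1 h2.ne
  set f : ℝ → Torus D → ℝ := fun ε θ =>
    Real.log ((muPlus ρ κ hκ).real (Metric.ball (θ, phiPlus ρ κ hκ θ) ε)) with hf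
  have hfm : ∀ ε, Measurable (f ε) := fun ε =>
    Real.measurable_log.comp ((measurable_muPlus_real_ball ε).comp measurable_graphMap)
  have hlow : ∀ ε, 0 < ε → ε ≤ 1 → ∀ᵐ θ ∂(leb D),
      -(logConst D b + 8 * D * Real.log b * G θ) + D * Real.log ε ≤ f ε θ := by
    intro ε h0 h1
    filter_upwards [hae] with θ hθ
    obtain ⟨j, hj, hjG⟩ := hθ
    refine le_trans ?_ (le_log_muPlus_ball (hκ := hκ) hS hρ hj h0 h1)
    gcongr
  have hup : ∀ ε, 0 < ε → ∀ᵐ θ ∂(leb D), f ε θ ≤ D * Real.log 2 + D * Real.log ε := by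
    intro ε h0
    filter_upwards [hae] with θ hθ
    obtain ⟨j, hj, -⟩ := hθ
    exact log_muPlus_ball_le h0 (muPlus_real_ball_pos hS hρ hj h0)
  have hlowint : ∀ ε : ℝ, Integrable (fun θ =>
      -(logConst D b + 8 * D * Real.log b * G θ) + D * Real.log ε) (leb D) := fun ε =>
    (((integrable_const _).add (hGint.const_mul _)).neg).add (integrable_const _)
  have hint : ∀ ε, 0 < ε → Integrable (f ε) (leb D) := by
    intro ε h0
    -- The lower bound is available for radii at most 1; larger balls are handled by monotonicity,
    -- since the logarithm of a probability is nonpositive.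
    have hm : 0 < min ε 1 := lt_min h0 one_pos
    refine (hlowint (min ε 1)).mono (hfm ε).aestronglyMeasurable ?_
    filter_upwards [hlow (min ε 1) hm (min_le_right _ _), hae] with θ h1 h2
    obtain ⟨j, hj, -⟩ := h2
    have h3 : f (min ε 1) θ ≤ f ε θ :=
      Real.log_le_log (muPlus_real_ball_pos hS hρ hj hm)
        (measureReal_mono (Metric.ball_subset_ball (min_le_left _ _)))
    have h4 : f ε θ ≤ 0 := Real.log_nonpos measureReal_nonneg measureReal_le_one
    rw [Real.norm_eq_abs, Real.norm_eq_abs, abs_of_nonpos h4]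
    exact (neg_le_neg (h1.trans h3)).trans (neg_le_abs _)
  have hmap : ∀ ε, ∫ x, Real.log ((muPlus ρ κ hκ).real (Metric.ball x ε)) ∂(muPlus ρ κ hκ) =
      ∫ θ, f ε θ ∂(leb D) := fun ε =>
    integral_map measurable_graphMap.aemeasurable
      (Real.measurable_log.comp (measurable_muPlus_real_ball ε)).aestronglyMeasurable
  have ht := tendsto_coe_ereal (s := D) (tendsto_div_log (s := D)
    (g := fun ε => ∫ x, Real.log ((muPlus ρ κ hκ).real (Metric.ball x ε)) ∂(muPlus ρ κ hκ))
    (C := logConst D b + 8 * D * Real.log b * ∫ θ, G θ ∂(leb D)) (C' := D * Real.log 2)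
    (fun ε h0 h1 => by
      rw [hmap]
      refine le_trans (le_of_eq ?_) (integral_mono_ae (hlowint ε) (hint ε h0) (hlow ε h0 h1))
      have hI : Integrable (fun θ => logConst D b + 8 * D * Real.log b * G θ) (leb D) :=
        (integrable_const _).add (hGint.const_mul _)
      have hI' : Integrable (fun θ => -(logConst D b + 8 * D * Real.log b * G θ)) (leb D) := hI.neg
      rw [integral_add hI' (integrable_const _), integral_neg,
        integral_add (integrable_const _) (hGint.const_mul _), integral_const_mul]
      simp)
    (fun ε h0 _ => by
      rw [hmap]
      refine (integral_mono_ae (hint ε h0) (integrable_const _) (hup ε h0)).trans (le_of_eq ?_)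
      simp))
  refine ⟨fun ε h0 => ?_, ht.liminf_eq, ht.limsup_eq⟩
  exact (integrable_map_measure
    (Real.measurable_log.comp (measurable_muPlus_real_ball ε)).aestronglyMeasurable
    measurable_graphMap.aemeasurable).2 (hint ε h0)

end Measure

/-! ### Hausdorff measure of the graph -/

section Hausdorff

variable {D : ℕ} {ρ : Fin D → ℝ} {c d κ b : ℝ} {hκ : 0 < κ}

lemma exists_nat_mem_of_lt {y w : ℝ} {N : ℕ} (hw : 0 < w) (hy : 0 ≤ y) (hyN : y < N * w) :
    ∃ q : Fin N, q * w ≤ y ∧ y ≤ (q + 1) * w := by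
  have h1 : y / w < N := by rwa [div_lt_iff₀ hw]
  refine ⟨⟨⌊y / w⌋₊, (Nat.floor_lt (by positivity)).2 h1⟩, ?_, ?_⟩
  · rw [← le_div_iff₀ hw]; exact Nat.floor_le (by positivity)
  · rw [← div_le_iff₀ hw]; exact (Nat.lt_floor_add_one _).le

/-- If the oscillation of `φ⁺` on small subsets of a piece of a ball is at most `H` times the
diameter, the graph over it is covered by `N ^ D * (⌊2 H⌋ + 1)` small sets. -/
lemma exists_cover_graphOver (hD : 1 ≤ D) {S : Set (Torus D)} {τ : Torus D} {R H : ℝ} {N : ℕ}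
    (hR : 0 < R) (hN : 1 ≤ N) (hS : S ⊆ Metric.ball τ R)
    (hosc : ∀ θ ∈ S, ∀ θ' ∈ S, dist θ θ' ≤ D * (2 * R / N) →
      |(phiPlus ρ κ hκ θ : ℝ) - phiPlus ρ κ hκ θ'| ≤ H * (D * (2 * R / N))) :
    ∃ t : (Fin D → Fin N) × Fin (⌊2 * H⌋₊ + 1) → Set (Torus D × I),
      (∀ i, Metric.ediam (t i) ≤ ENNReal.ofReal (D * (2 * R / N))) ∧
        graphOver ρ κ hκ S ⊆ ⋃ i, t i := by
  have hN' : (0 : ℝ) < N := by exact_mod_cast hN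
  have hD' : (0 : ℝ) < D := by exact_mod_cast hD
  set w : ℝ := 2 * R / N with hw
  have hw0 : 0 < w := by positivity
  set δ : ℝ := D * w with hδ
  have hδ0 : 0 < δ := by positivity
  let cell : (Fin D → Fin N) → Set (Torus D) := fun q =>
    {θ | ∀ i, ∃ x : ℝ, (x : UnitAddCircle) = θ i - τ i ∧ q i * w ≤ x + R ∧ x + R ≤ (q i + 1) * w}
  have hcell : ∀ q, ∀ θ ∈ cell q, ∀ θ' ∈ cell q, dist θ θ' ≤ δ := by
    intro q θ hθ θ' hθ'
    refine (dist_le_sum θ θ').trans ?_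
    have hi : ∀ i ∈ Finset.univ, dist (θ i) (θ' i) ≤ w := by
      intro i _
      obtain ⟨x, hx, hx1, hx2⟩ := hθ i
      obtain ⟨y, hy, hy1, hy2⟩ := hθ' i
      have h1 : θ i - θ' i = ((x - y : ℝ) : UnitAddCircle) := by
        rw [AddCircle.coe_sub, hx, hy]; abel
      rw [dist_eq_norm, h1]
      refine (QuotientAddGroup.norm_mk_le_norm).trans ?_
      rw [Real.norm_eq_abs, abs_le]
      constructor <;> linarith
    refine (Finset.sum_le_sum hi).trans (le_of_eq ?_)
    simp [hδ]
  -- Over one cell all values of `φ⁺` lie within `H * δ` of a reference value, hence in an interval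
  -- of length `2 * H * δ`, to be cut into `⌊2 * H⌋₊ + 1` pieces of length `δ`.
  have hbase : ∀ q, ∃ a : ℝ, ∀ θ ∈ S, θ ∈ cell q →
      a ≤ phiPlus ρ κ hκ θ ∧ (phiPlus ρ κ hκ θ : ℝ) ≤ a + 2 * H * δ := by
    intro q
    by_cases hex : ∃ θ, θ ∈ S ∧ θ ∈ cell q
    · obtain ⟨θ₀, h0, h0'⟩ := hex
      refine ⟨phiPlus ρ κ hκ θ₀ - H * δ, fun θ hθ hθ' => ?_⟩
      have := abs_le.1 (hosc θ hθ θ₀ h0 (hcell q θ hθ' θ₀ h0'))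
      constructor <;> linarith [this.1, this.2]
    · exact ⟨0, fun θ h h' => absurd ⟨θ, h, h'⟩ hex⟩
  choose a ha using hbase
  refine ⟨fun i => {p | p.1 ∈ cell i.1 ∧ a i.1 + i.2 * δ ≤ p.2 ∧
    (p.2 : ℝ) ≤ a i.1 + (i.2 + 1) * δ}, ?_, ?_⟩
  · rintro ⟨q, m⟩
    refine Metric.ediam_le_of_forall_dist_le ?_
    rintro p ⟨hp, hp1, hp2⟩ p' ⟨hp', hp1', hp2'⟩
    refine max_le (hcell q _ hp _ hp') ?_
    change |(p.2 : ℝ) - p'.2| ≤ δ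
    rw [abs_le]
    constructor <;> linarith
  · rintro p ⟨hp, hp2⟩
    have hx : ∀ i, ∃ x : ℝ, ∃ q : Fin N, (x : UnitAddCircle) = p.1 i - τ i ∧
        q * w ≤ x + R ∧ x + R ≤ (q + 1) * w := by
      intro i
      obtain ⟨x, hx, hx2, -⟩ := exists_lift (p.1 i - τ i)
      have h1 : |x| < R := by
        rw [hx2, ← dist_eq_norm]
        exact (dist_apply_le p.1 τ i).trans_lt (hS hp)
      obtain ⟨q, hq⟩ := exists_nat_mem_of_lt (y := x + R) (N := N) hw0
        (by linarith [(abs_lt.1 h1).1]) (by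
          have : N * w = 2 * R := by rw [hw]; field_simp
          linarith [(abs_lt.1 h1).2])
      exact ⟨x, q, hx, hq⟩
    choose x q hq using hx
    have hcq : p.1 ∈ cell q := fun i => ⟨x i, hq i⟩
    have h2 := ha q p.1 hp hcq
    obtain ⟨m, hm⟩ := exists_nat_mem_of_lt (y := (p.2 : ℝ) - a q) (N := ⌊2 * H⌋₊ + 1) hδ0
      (by rw [hp2]; linarith [h2.1]) (by
        have h3 : 2 * H * δ < (⌊2 * H⌋₊ + 1) * δ := by
          gcongr; exact Nat.lt_floor_add_one _
        rw [hp2]; push_cast; linarith [h2.2])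
    refine mem_iUnion.2 ⟨(q, m), hcq, ?_, ?_⟩ <;> linarith [hm.1, hm.2]

/-- The Hausdorff measure of a Lipschitz piece of the graph grows linearly with the Lipschitz
constant. -/
lemma hausdorffMeasure_graphOver_le (hD : 1 ≤ D) {S : Set (Torus D)} {τ : Torus D} {R K : ℝ}
    (hR : 0 < R) (hK : 0 ≤ K) (hS : S ⊆ Metric.ball τ R)
    (hlip : ∀ θ ∈ S, ∀ θ' ∈ S,
      |(phiPlus ρ κ hκ θ : ℝ) - phiPlus ρ κ hκ θ'| ≤ K * dist θ θ') :
    μH[(D : ℝ)] (graphOver ρ κ hκ S) ≤ ENNReal.ofReal ((2 * K + 1) * (D * (2 * R)) ^ D) := by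
  have hcov := fun N : ℕ => exists_cover_graphOver (ρ := ρ) (hκ := hκ) hD (N := N + 1) hR
    (by omega) hS (fun θ h θ' h' hd => (hlip θ h θ' h').trans (by gcongr))
  choose t ht hst using hcov
  have hlim : Tendsto (fun N : ℕ => ENNReal.ofReal (D * (2 * R / ((N + 1 : ℕ) : ℝ)))) atTop
      (𝓝 0) := by
    have h1 : Tendsto (fun N : ℕ => (D : ℝ) * (2 * R / ((N + 1 : ℕ) : ℝ))) atTop (𝓝 0) := by
      have h2 := ((tendsto_const_div_atTop_nhds_zero_nat (2 * R)).comp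
        (tendsto_add_atTop_nat 1)).const_mul (D : ℝ)
      rw [mul_zero] at h2
      exact h2
    have := (ENNReal.continuous_ofReal.tendsto 0).comp h1
    rwa [ENNReal.ofReal_zero] at this
  refine (Measure.hausdorffMeasure_le_liminf_sum (D : ℝ) _ _ hlim t (Eventually.of_forall ht)
    (Eventually.of_forall hst)).trans ?_
  refine liminf_le_of_le (by isBoundedDefault) fun B hB => ?_
  obtain ⟨N, hN⟩ := hB.exists
  refine hN.trans ?_
  have hpos : (0 : ℝ) < ((N + 1 : ℕ) : ℝ) := by positivity
  -- The number of cells cancels the scaling of their diameters, so the sum is bounded independently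
  -- of `N`. The constant enters to the first power because only the one-dimensional fibre is
  -- subdivided.
  calc ∑ i, Metric.ediam (t N i) ^ (D : ℝ)
      ≤ ∑ _i : (Fin D → Fin (N + 1)) × Fin (⌊2 * K⌋₊ + 1),
          ENNReal.ofReal ((D * (2 * R / ((N + 1 : ℕ) : ℝ))) ^ D) := by
        refine Finset.sum_le_sum fun i _ => ?_
        rw [ENNReal.ofReal_pow (by positivity), ENNReal.rpow_natCast]
        gcongr
        exact ht N i
    _ = ENNReal.ofReal ((⌊2 * K⌋₊ + 1) * (D * (2 * R)) ^ D) := by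
        rw [Finset.sum_const, nsmul_eq_mul, ← ENNReal.ofReal_natCast,
          ← ENNReal.ofReal_mul (by positivity)]
        congr 1
        simp only [Finset.card_univ, Fintype.card_prod, Fintype.card_fun, Fintype.card_fin]
        rw [mul_div_assoc', div_pow]
        push_cast
        field_simp
    _ ≤ ENNReal.ofReal ((2 * K + 1) * (D * (2 * R)) ^ D) := by
        refine ENNReal.ofReal_le_ofReal ?_
        gcongr
        exact Nat.floor_le (by positivity)

lemma hausdorffMeasure_graphOver_regular_le (hS : IsSteep D c d κ b) (hρ : IsDiophantine c d ρ)
    {S : Set (Torus D)} {j : ℕ} (hSj : S ⊆ regular ρ b j) {τ : Torus D} {R : ℝ} (hR : 0 < R)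
    (hSR : S ⊆ Metric.ball τ R) :
    μH[(D : ℝ)] (graphOver ρ κ hκ S) ≤
      ENNReal.ofReal ((2 * lipConst b j + 1) * (D * (2 * R)) ^ D) :=
  hausdorffMeasure_graphOver_le hS.one_le_dim hR (by linarith [one_le_lipConst hS j]) hSR
    fun _ h _ h' => abs_phiPlus_sub_le hS hρ (hSj h) (hSj h')

lemma subset_ball_zero (S : Set (Torus D)) : S ⊆ Metric.ball 0 (D + 1) := by
  intro θ _
  rw [Metric.mem_ball]
  have h : ∀ i ∈ Finset.univ, dist (θ i) ((0 : Torus D) i) ≤ 1 := by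
    intro i _
    obtain ⟨x, hx, hx2, hx3⟩ := exists_lift (θ i)
    have h1 : dist (θ i) ((0 : Torus D) i) = ‖θ i‖ := by simp
    rw [h1, ← hx2]; linarith
  have h2 := (dist_le_sum θ 0).trans (Finset.sum_le_sum h)
  simp at h2 ⊢
  linarith

lemma hausdorffMeasure_graphOver_regular_lt_top (hS : IsSteep D c d κ b)
    (hρ : IsDiophantine c d ρ) (j : ℕ) : μH[(D : ℝ)] (graphOver ρ κ hκ (regular ρ b j)) < ∞ :=
  (hausdorffMeasure_graphOver_regular_le hS hρ subset_rfl (by positivity)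
    (subset_ball_zero _)).trans_lt ENNReal.ofReal_lt_top

/-- The graph over the exceptional set has vanishing `s`-dimensional measure for `s > 1`. -/
lemma hausdorffMeasure_graphOver_compl (hS : IsSteep D c d κ b) {s : ℝ} (hs : 1 < s) :
    μH[s] (graphOver ρ κ hκ (⋃ j, regular ρ b j)ᶜ) = 0 := by
  have hr := hS.inv_pos
  have hr1 := hS.inv_le_one
  have hr20 := hS.inv_le_one_twentieth
  have hD := hS.one_le_dim
  have hD' := hS.dim_pos
  set E : Set (Torus D) := (⋃ j, regular ρ b j)ᶜ with hE
  let R : ℕ → ℕ → ℝ := fun j i => b⁻¹ ^ (i + 1 + j)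
  have hR : ∀ j i, 0 < R j i := fun j i => by positivity
  let δ : ℕ → ℕ → ℝ := fun j i => D * (2 * R j i / ((1 : ℕ) : ℝ))
  have hδ0 : ∀ j i, 0 < δ j i := fun j i => by
    have := hR j i
    simp only [δ]; positivity
  have hδ : ∀ j i, δ j i ≤ b⁻¹ ^ (i + j) := by
    intro j i
    have h6 : b⁻¹ * (16 * D) ≤ 1 := by
      rw [inv_mul_le_one₀ hS.pos]; exact hS.sixteen_mul_dim_le
    have h7 : δ j i = b⁻¹ ^ (i + j) * (b⁻¹ * (2 * D)) := by
      simp only [δ, R, Nat.cast_one]; ring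
    rw [h7]
    refine mul_le_of_le_one_right (by positivity) (le_trans ?_ h6)
    gcongr; norm_num
  -- A single cell per ball is enough: the oscillation is at most `1 = δ⁻¹ * δ`, so about `δ⁻¹`
  -- boxes of size `δ` cover the graph over the ball. Their contribution is of order `δ ^ (s - 1)`,
  -- which explains `s > 1`.
  have hcov := fun j i : ℕ => exists_cover_graphOver (ρ := ρ) (hκ := hκ) hD
    (S := E ∩ Metric.ball ((i + 1) • toTorus ρ) (R j i)) (N := 1) (H := (δ j i)⁻¹) (hR j i) le_rfl
    inter_subset_right (fun θ _ θ' _ _ => by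
      have h1 := (phiPlus ρ κ hκ θ).2
      have h2 := (phiPlus ρ κ hκ θ').2
      change _ ≤ (δ j i)⁻¹ * δ j i
      rw [inv_mul_cancel₀ (hδ0 j i).ne', abs_le]
      constructor <;> linarith [h1.1, h1.2, h2.1, h2.2])
  choose t ht hst using hcov
  set q : ℝ := b⁻¹ ^ (s - 1) with hq
  have hq0 : 0 ≤ q := by positivity
  have hq1 : q < 1 := Real.rpow_lt_one hr.le (by linarith) (by linarith)
  have hlim : Tendsto (fun j : ℕ => ENNReal.ofReal (b⁻¹ ^ j)) atTop (𝓝 0) := by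
    have := (ENNReal.continuous_ofReal.tendsto 0).comp (tendsto_inv_pow hS)
    rwa [ENNReal.ofReal_zero] at this
  have hsum : ∀ j i : ℕ, ∑' m, Metric.ediam (t j i m) ^ s ≤
      ENNReal.ofReal (3 * q ^ j) * ENNReal.ofReal q ^ i := by
    intro j i
    rw [tsum_fintype]
    calc ∑ m, Metric.ediam (t j i m) ^ s
        ≤ ∑ _m : (Fin D → Fin 1) × Fin (⌊2 * (δ j i)⁻¹⌋₊ + 1), ENNReal.ofReal (δ j i ^ s) := by
          refine Finset.sum_le_sum fun m _ => ?_
          rw [← ENNReal.ofReal_rpow_of_pos (hδ0 j i)]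
          exact ENNReal.rpow_le_rpow (ht j i m) (by linarith)
      _ = ENNReal.ofReal ((⌊2 * (δ j i)⁻¹⌋₊ + 1) * δ j i ^ s) := by
          rw [Finset.sum_const, nsmul_eq_mul, ← ENNReal.ofReal_natCast,
            ← ENNReal.ofReal_mul (by positivity)]
          congr 1
          simp
      _ ≤ ENNReal.ofReal (3 * q ^ j * q ^ i) := by
          refine ENNReal.ofReal_le_ofReal ?_
          have h0 := hδ0 j i
          have h1 : δ j i ≤ 1 := (hδ j i).trans (pow_le_one₀ hr.le hr1)
          have h2 : (⌊2 * (δ j i)⁻¹⌋₊ : ℝ) + 1 ≤ 3 * (δ j i)⁻¹ := by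
            have h3 : (⌊2 * (δ j i)⁻¹⌋₊ : ℝ) ≤ 2 * (δ j i)⁻¹ := Nat.floor_le (by positivity)
            have h4 : 1 ≤ (δ j i)⁻¹ := (one_le_inv₀ h0).2 h1
            linarith
          calc ((⌊2 * (δ j i)⁻¹⌋₊ : ℝ) + 1) * δ j i ^ s ≤ 3 * (δ j i)⁻¹ * δ j i ^ s := by gcongr
            _ = 3 * δ j i ^ (s - 1) := by rw [Real.rpow_sub_one h0.ne']; field_simp
            _ ≤ 3 * (b⁻¹ ^ (i + j)) ^ (s - 1) := by
                gcongr
                exact hδ j i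
            _ = 3 * q ^ j * q ^ i := by
                rw [← Real.rpow_natCast, ← Real.rpow_mul hr.le, mul_comm ((i + j : ℕ) : ℝ),
                  Real.rpow_mul hr.le, Real.rpow_natCast, ← hq]
                ring
      _ = ENNReal.ofReal (3 * q ^ j) * ENNReal.ofReal q ^ i := by
          rw [ENNReal.ofReal_mul (by positivity), ENNReal.ofReal_pow hq0 i]
  have hbound := Measure.hausdorffMeasure_le_liminf_tsum s (graphOver ρ κ hκ E)
    (fun j : ℕ => ENNReal.ofReal (b⁻¹ ^ j)) hlim
    (fun j (m : Σ i : ℕ, (Fin D → Fin 1) × Fin (⌊2 * (δ j i)⁻¹⌋₊ + 1)) => t j m.1 m.2)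
    (Eventually.of_forall fun j m => (ht j m.1 m.2).trans (ENNReal.ofReal_le_ofReal
      ((hδ j m.1).trans (pow_le_pow_of_le_one hr.le hr1 (by omega)))))
    (Eventually.of_forall fun j p hp => by
      have h1 : p.1 ∈ (regular ρ b j)ᶜ := fun h => hp.1 (mem_iUnion.2 ⟨j, h⟩)
      rw [compl_regular, mem_iUnion] at h1
      obtain ⟨i, hi⟩ := h1
      have h2 : p ∈ graphOver ρ κ hκ (E ∩ Metric.ball ((i + 1) • toTorus ρ) (R j i)) :=
        ⟨⟨hp.1, hi⟩, hp.2⟩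
      obtain ⟨m, hm⟩ := mem_iUnion.1 (hst j i h2)
      exact mem_iUnion.2 ⟨⟨i, m⟩, hm⟩)
  have hzero : Tendsto (fun j : ℕ => ENNReal.ofReal (3 * q ^ j) * (1 - ENNReal.ofReal q)⁻¹) atTop
      (𝓝 0) := by
    have h1 : Tendsto (fun j : ℕ => ENNReal.ofReal (3 * q ^ j)) atTop (𝓝 0) := by
      have h2 := (tendsto_pow_atTop_nhds_zero_of_lt_one hq0 hq1).const_mul 3
      rw [mul_zero] at h2
      have := (ENNReal.continuous_ofReal.tendsto 0).comp h2
      rwa [ENNReal.ofReal_zero] at this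
    have h3 : (1 - ENNReal.ofReal q)⁻¹ ≠ ∞ := by
      rw [ENNReal.inv_ne_top]
      have : ENNReal.ofReal q < 1 := by rwa [ENNReal.ofReal_lt_one]
      exact (tsub_pos_of_lt this).ne'
    have := ENNReal.Tendsto.mul_const h1 (Or.inr h3)
    rwa [zero_mul] at this
  have hle : liminf (fun j : ℕ =>
      ∑' m : Σ i : ℕ, (Fin D → Fin 1) × Fin (⌊2 * (δ j i)⁻¹⌋₊ + 1),
        Metric.ediam (t j m.1 m.2) ^ s) atTop ≤ 0 := by
    rw [← hzero.liminf_eq]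
    refine liminf_le_liminf (Eventually.of_forall fun j => ?_)
    rw [ENNReal.tsum_sigma' (fun m : Σ i : ℕ, (Fin D → Fin 1) × Fin (⌊2 * (δ j i)⁻¹⌋₊ + 1) =>
      Metric.ediam (t j m.1 m.2) ^ s), ← ENNReal.tsum_geometric, ← ENNReal.tsum_mul_left]
    exact ENNReal.tsum_le_tsum fun i => hsum j i
  exact le_antisymm (hbound.trans hle) bot_le

/-! ### Comparison of Lebesgue and Hausdorff measure on the torus -/

/-- A nonempty set of finite diameter `r` lies in a closed ball of radius `r`, of volume at most `(2
* r) ^ D`. -/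
lemma leb_le_hausdorffMeasure (s : Set (Torus D)) :
    leb D s ≤ 2 ^ D * μH[(D : ℝ)] s := by
  have hle : (2 ^ D : ℝ≥0∞)⁻¹ • leb D ≤ μH[(D : ℝ)] := by
    refine Measure.le_hausdorffMeasure _ _ 1 one_pos fun s hs => ?_
    rw [Measure.smul_apply, smul_eq_mul, ENNReal.rpow_natCast]
    rcases s.eq_empty_or_nonempty with rfl | ⟨x, hx⟩
    · simp
    have hfin : Metric.ediam s ≠ ∞ := ne_top_of_le_ne_top ENNReal.one_ne_top hs
    have hsub : s ⊆ Metric.closedBall x (Metric.ediam s).toReal := fun y hy => by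
      rw [Metric.mem_closedBall, dist_edist]
      exact ENNReal.toReal_mono hfin (Metric.edist_le_ediam_of_mem hy hx)
    have h2 : leb D s ≤ 2 ^ D * Metric.ediam s ^ D := by
      refine (measure_mono hsub).trans ((leb_closedBall_le _ _).trans (le_of_eq ?_))
      rw [ENNReal.ofReal_mul (by norm_num), ENNReal.ofReal_toReal hfin, mul_pow]
      norm_num
    calc (2 ^ D : ℝ≥0∞)⁻¹ * leb D s ≤ (2 ^ D : ℝ≥0∞)⁻¹ * (2 ^ D * Metric.ediam s ^ D) := by gcongr
      _ = Metric.ediam s ^ D := by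
        rw [← mul_assoc, ENNReal.inv_mul_cancel (by positivity) (by finiteness), one_mul]
  have h := hle s
  rw [Measure.smul_apply, smul_eq_mul, ENNReal.inv_mul_le_iff (by positivity) (by finiteness)] at h
  exact h

lemma image_fst_graphOver (S : Set (Torus D)) : Prod.fst '' graphOver ρ κ hκ S = S := by
  ext θ
  constructor
  · rintro ⟨p, hp, rfl⟩; exact hp.1
  · intro h; exact ⟨(θ, phiPlus ρ κ hκ θ), ⟨h, rfl⟩, rfl⟩

theorem dimH_graphPlus (hS : IsSteep D c d κ b) (hρ : IsDiophantine c d ρ) :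
    dimH (graphPlus ρ κ hκ) = (D : ℝ≥0∞) := by
  rw [graphPlus_eq_graphOver_univ]
  refine le_antisymm ?_ ?_
  · rw [← union_compl_self (⋃ j, regular ρ b j), graphOver_union, graphOver_iUnion, dimH_union,
      dimH_iUnion]
    -- The regular pieces have finite `ℋ^D`; the exceptional piece is null for every `s > D ≥ 1`.
    -- The lower bound below comes from projecting to the torus.
    refine max_le (iSup_le fun j => ?_) (dimH_le fun s hs => ?_)
    · have h := (hausdorffMeasure_graphOver_regular_lt_top (hκ := hκ) hS hρ j).ne
      exact dimH_le_of_hausdorffMeasure_ne_top (d := (D : ℝ≥0)) (by simpa using h)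
    · by_contra hcon
      have h1 : (D : ℝ≥0) < s := by
        rw [not_le] at hcon
        exact_mod_cast hcon
      have h2 : (1 : ℝ) < s := by
        have h3 : (1 : ℝ≥0) ≤ D := by exact_mod_cast hS.one_le_dim
        exact_mod_cast h3.trans_lt h1
      rw [hausdorffMeasure_graphOver_compl hS h2] at hs
      exact ENNReal.zero_ne_top hs
  · have h1 : dimH (univ : Set (Torus D)) ≤ dimH (graphOver ρ κ hκ univ) := by
      have h2 := (LipschitzWith.prod_fst (α := Torus D) (β := I)).dimH_image_le
        (graphOver ρ κ hκ univ)
      rwa [image_fst_graphOver] at h2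
    refine le_trans ?_ h1
    have h3 : μH[((D : ℝ≥0) : ℝ)] (univ : Set (Torus D)) ≠ 0 := by
      intro h0
      have h4 := leb_le_hausdorffMeasure (D := D) univ
      rw [NNReal.coe_natCast] at h0
      rw [h0, mul_zero, measure_univ] at h4
      exact absurd h4 (by simp)
    have h5 := le_dimH_of_hausdorffMeasure_ne_zero h3
    simpa using h5

theorem hausdorffMeasure_graphPlus_lt_top (hS : IsSteep D c d κ b) (hρ : IsDiophantine c d ρ)
    (hD : 16 ≤ D) : μH[(D : ℝ)] (graphPlus ρ κ hκ) < ∞ := by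
  have hr := hS.inv_pos
  have hr1 := hS.inv_le_one
  have hD' := hS.dim_pos
  have hb := hS.pos
  -- A point whose least index is `j + 1` lies in one of the balls excluded at level `j`, where `φ⁺`
  -- is still Lipschitz on `regular (j + 1)`.
  have hcover : (univ : Set (Torus D)) = (regular ρ b 0 ∪ ⋃ j : ℕ, ⋃ i : ℕ,
      (regular ρ b (j + 1) ∩ Metric.ball ((i + 1) • toTorus ρ) (b⁻¹ ^ (i + 1 + j)))) ∪
      (⋃ j, regular ρ b j)ᶜ := by
    refine (eq_univ_of_forall fun θ => ?_).symm
    by_cases h : ∃ j, θ ∈ regular ρ b j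
    · refine Or.inl ?_
      classical
      have h1 := Nat.find_spec h
      rcases hj : Nat.find h with _ | j
      · rw [hj] at h1; exact Or.inl h1
      · rw [hj] at h1
        refine Or.inr (mem_iUnion.2 ⟨j, ?_⟩)
        have h2 : θ ∈ (regular ρ b j)ᶜ := Nat.find_min h (by omega)
        rw [compl_regular, mem_iUnion] at h2
        obtain ⟨i, hi⟩ := h2
        exact mem_iUnion.2 ⟨i, h1, hi⟩
    · exact Or.inr fun h' => h (mem_iUnion.1 h')
  rw [graphPlus_eq_graphOver_univ, hcover, graphOver_union, graphOver_union, graphOver_iUnion]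
  simp only [graphOver_iUnion]
  refine measure_union_lt_top (measure_union_lt_top
    (hausdorffMeasure_graphOver_regular_lt_top hS hρ 0) ?_) ?_
  · set q : ℝ≥0∞ := ENNReal.ofReal b⁻¹ with hq
    have hq1 : q < 1 := by
      rw [hq, ENNReal.ofReal_lt_one]
      linarith [hS.inv_le_one_twentieth]
    have hpiece : ∀ j i : ℕ, μH[(D : ℝ)] (graphOver ρ κ hκ
        (regular ρ b (j + 1) ∩ Metric.ball ((i + 1) • toTorus ρ) (b⁻¹ ^ (i + 1 + j)))) ≤
        ENNReal.ofReal (3 * b ^ 537) * q ^ j * q ^ i := by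
      intro j i
      refine (hausdorffMeasure_graphOver_regular_le hS hρ inter_subset_left (by positivity)
        inter_subset_right).trans ?_
      rw [hq, ← ENNReal.ofReal_pow hr.le, ← ENNReal.ofReal_pow hr.le,
        ← ENNReal.ofReal_mul (by positivity), ← ENNReal.ofReal_mul (by positivity)]
      refine ENNReal.ofReal_le_ofReal ?_
      have h1 := one_le_lipConst hS (j + 1)
      have h6 : b⁻¹ * (16 * D) ≤ 1 := by
        rw [inv_mul_le_one₀ hb]; exact hS.sixteen_mul_dim_le
      have h7 : D * (2 * b⁻¹ ^ (i + 1 + j)) ≤ b⁻¹ ^ (i + j) := by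
        have h8 : D * (2 * b⁻¹ ^ (i + 1 + j)) = b⁻¹ ^ (i + j) * (b⁻¹ * (2 * D)) := by ring
        rw [h8]
        refine mul_le_of_le_one_right (by positivity) (le_trans ?_ h6)
        gcongr; norm_num
      calc (2 * lipConst b (j + 1) + 1) * (D * (2 * b⁻¹ ^ (i + 1 + j))) ^ D
          ≤ (3 * lipConst b (j + 1)) * (b⁻¹ ^ (i + j)) ^ D := by
            gcongr
            linarith
        -- The Lipschitz constant grows like `b ^ (8 * j)`; the exponent 16 leaves `b⁻¹ ^ (8 * j +
        -- 16 * i)`, summable in both indices.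
        _ ≤ (3 * lipConst b (j + 1)) * (b⁻¹ ^ (i + j)) ^ 16 := by
            refine mul_le_mul_of_nonneg_left ?_ (by positivity)
            exact pow_le_pow_of_le_one (by positivity) (pow_le_one₀ hr.le hr1) hD
        _ = 3 * b ^ 537 * (b * b⁻¹) ^ (8 * j) * (b⁻¹ ^ (8 * j) * b⁻¹ ^ (16 * i)) := by
            rw [lipConst, mul_pow]; ring
        _ ≤ 3 * b ^ 537 * (b⁻¹ ^ j * b⁻¹ ^ i) := by
            rw [mul_inv_cancel₀ hb.ne', one_pow, mul_one]
            gcongr 3 * b ^ 537 * (?_ * ?_)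
            · exact pow_le_pow_of_le_one hr.le hr1 (by omega)
            · exact pow_le_pow_of_le_one hr.le hr1 (by omega)
        _ = 3 * b ^ 537 * b⁻¹ ^ j * b⁻¹ ^ i := by ring
    have hgeom : (1 - q)⁻¹ ≠ ∞ := by
      rw [ENNReal.inv_ne_top]; exact (tsub_pos_of_lt hq1).ne'
    refine (measure_iUnion_le _).trans_lt ?_
    refine lt_of_le_of_lt (b := ∑' j : ℕ, ∑' i : ℕ, ENNReal.ofReal (3 * b ^ 537) * q ^ j * q ^ i)
      (ENNReal.tsum_le_tsum fun j => (measure_iUnion_le _).trans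
        (ENNReal.tsum_le_tsum fun i => hpiece j i)) ?_
    simp_rw [ENNReal.tsum_mul_left, ENNReal.tsum_mul_right, ENNReal.tsum_mul_left,
      ENNReal.tsum_geometric]
    finiteness
  · rw [hausdorffMeasure_graphOver_compl hS (by
      have : (16 : ℝ) ≤ D := by exact_mod_cast hD
      linarith)]
    exact ENNReal.zero_lt_top

/-! ### Rectifiability -/

lemma lipschitz_toTorus (x y : EuclideanSpace ℝ (Fin D)) :
    dist (toTorus x.ofLp) (toTorus y.ofLp) ≤ dist x y := by
  rw [PiLp.dist_eq_of_L2, PiLp.dist_eq_of_L2]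
  refine Real.sqrt_le_sqrt (Finset.sum_le_sum fun i _ => ?_)
  gcongr
  rw [dist_eq_norm, dist_eq_norm]
  exact QuotientAddGroup.norm_mk_le_norm

lemma exists_toTorus_eq (θ : Torus D) :
    ∃ x : EuclideanSpace ℝ (Fin D), toTorus x.ofLp = θ := by
  choose x hx using fun i => exists_lift (θ i)
  refine ⟨WithLp.toLp 2 x, ?_⟩
  ext i
  exact (hx i).1

lemma isCountablyRectifiable_graphOver (hS : IsSteep D c d κ b) (hρ : IsDiophantine c d ρ) :
    IsCountablyRectifiable D (graphOver ρ κ hκ (⋃ j, regular ρ b j)) := by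
  refine ⟨measurableSet_graphOver (MeasurableSet.iUnion fun j =>
    (isClosed_regular j).measurableSet), fun j => {x | toTorus x.ofLp ∈ regular ρ b j},
    fun j x => (toTorus x.1.ofLp, phiPlus ρ κ hκ (toTorus x.1.ofLp)), fun j => ?_, ?_⟩
  · have hK := one_le_lipConst hS j
    refine ⟨(lipConst b j).toNNReal, LipschitzWith.of_dist_le_mul fun x y => ?_⟩
    rw [Real.coe_toNNReal _ (by linarith)]
    have h1 := lipschitz_toTorus x.1 y.1
    have h0 : (0 : ℝ) ≤ dist x.1 y.1 := dist_nonneg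
    refine max_le (h1.trans ?_) ((abs_phiPlus_sub_le hS hρ x.2 y.2).trans ?_)
    · exact le_mul_of_one_le_left h0 hK
    · exact mul_le_mul_of_nonneg_left h1 (by linarith)
  · have hempty : graphOver ρ κ hκ (⋃ j, regular ρ b j) \ ⋃ j, range
        (fun x : {x : EuclideanSpace ℝ (Fin D) | toTorus x.ofLp ∈ regular ρ b j} =>
          ((toTorus x.1.ofLp, phiPlus ρ κ hκ (toTorus x.1.ofLp)) : Torus D × I)) = ∅ := by
      rw [sdiff_eq_empty]
      rintro p ⟨hp, hp2⟩
      obtain ⟨j, hj⟩ := mem_iUnion.1 hp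
      obtain ⟨x, hx⟩ := exists_toTorus_eq p.1
      refine mem_iUnion.2 ⟨j, ⟨⟨x, by rw [mem_ofPred_eq, hx]; exact hj⟩, ?_⟩⟩
      simp only [hx]
      exact Prod.ext rfl hp2.symm
    rw [hempty, measure_empty]

/-- Radon–Nikodym: `ℋ^D` restricted to the graph over the regular points is σ-finite, and it
dominates `μ` because projecting to the torus does not increase `ℋ^D`, which in turn dominates
Lebesgue measure. -/
theorem isRectifiableMeasure_muPlus (hS : IsSteep D c d κ b) (hρ : IsDiophantine c d ρ) :
    IsRectifiableMeasure D (muPlus ρ κ hκ) := by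
  refine ⟨inferInstance, _, isCountablyRectifiable_graphOver (hκ := hκ) hS hρ, ?_⟩
  set A := graphOver ρ κ hκ (⋃ j, regular ρ b j) with hA
  have hAm : MeasurableSet A :=
    measurableSet_graphOver (MeasurableSet.iUnion fun j => (isClosed_regular j).measurableSet)
  have hfin : SigmaFinite ((μH[(D : ℝ)] : Measure (Torus D × I)).restrict A) := by
    refine Measure.sigmaFinite_of_countable
      (S := insert Aᶜ (range fun j => graphOver ρ κ hκ (regular ρ b j)))
      ((countable_range _).insert _) ?_ ?_
    · rintro s (rfl | ⟨j, rfl⟩)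
      · rw [Measure.restrict_apply hAm.compl, compl_inter_self, measure_empty]
        exact ENNReal.zero_lt_top
      · exact (Measure.restrict_apply_le _ _).trans_lt
          (hausdorffMeasure_graphOver_regular_lt_top hS hρ j)
    · rw [sUnion_insert, sUnion_range, ← graphOver_iUnion, ← hA, compl_union_self]
  have hac : muPlus ρ κ hκ ≪ (μH[(D : ℝ)] : Measure (Torus D × I)).restrict A := by
    refine Measure.AbsolutelyContinuous.mk fun s hs h0 => ?_
    rw [Measure.restrict_apply hs] at h0
    have h1 : muPlus ρ κ hκ (s ∩ A) = 0 := by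
      rw [muPlus_apply ρ κ hκ (hs.inter hAm)]
      have h2 : μH[(D : ℝ)] (Prod.fst '' (s ∩ A)) ≤ 0 := by
        have h3 := (LipschitzWith.prod_fst (α := Torus D) (β := I)).hausdorffMeasure_image_le
          (d := (D : ℝ)) (by positivity) (s ∩ A)
        simpa [h0] using h3
      have h4 := leb_le_hausdorffMeasure (D := D) (Prod.fst '' (s ∩ A))
      rw [le_antisymm h2 bot_le, mul_zero] at h4
      exact measure_mono_null (image_mono inter_subset_left) (le_antisymm h4 bot_le)
    have h5 : muPlus ρ κ hκ Aᶜ = 0 := ae_mem_graphOver hS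
    exact measure_mono_null (fun p hp => (em (p ∈ A)).imp (fun h => ⟨hp, h⟩) id)
      (measure_union_null h1 h5)
  refine ⟨fun x => ((muPlus ρ κ hκ).rnDeriv (μH[(D : ℝ)].restrict A) x).toNNReal,
    (Measure.measurable_rnDeriv _ _).ennreal_toNNReal, ?_⟩
  conv_lhs => rw [← Measure.withDensity_rnDeriv_eq _ _ hac]
  refine withDensity_congr_ae ?_
  filter_upwards [Measure.rnDeriv_lt_top (muPlus ρ κ hκ) (μH[(D : ℝ)].restrict A)] with x hx
  exact (ENNReal.coe_toNNReal hx.ne).symm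

end Hausdorff

/-! ### The one-dimensional case -/

section OneDim

variable {ρ : Fin 1 → ℝ} {c d κ b : ℝ} {hκ : 0 < κ}

/-- The covering map of the one-dimensional torus. -/
def circ (x : ℝ) : Torus 1 := toTorus fun _ => x

lemma dist_eq_dist_apply (θ η : Torus 1) : dist θ η = dist (θ 0) (η 0) :=
  le_antisymm (by simpa using dist_le_sum θ η) (dist_apply_le θ η 0)

lemma dist_circ_le (x y : ℝ) : dist (circ x) (circ y) ≤ |x - y| := by
  rw [dist_eq_dist_apply, dist_eq_norm]
  exact QuotientAddGroup.norm_mk_le_norm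

lemma continuous_circ : Continuous circ :=
  (LipschitzWith.of_dist_le_mul (K := 1) fun x y => by
    simpa using! dist_circ_le x y).continuous

lemma exists_circ_eq_of_mem_ball {θ : Torus 1} {x t : ℝ} (h : θ ∈ Metric.ball (circ x) t) :
    ∃ y, circ y = θ ∧ |y - x| < t := by
  obtain ⟨z, hz, hz2, -⟩ := exists_lift (θ 0 - (x : UnitAddCircle))
  refine ⟨x + z, ?_, ?_⟩
  · ext i
    rw [Subsingleton.elim i 0]
    change ((x + z : ℝ) : UnitAddCircle) = θ 0
    rw [AddCircle.coe_add, hz]; abel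
  · rw [add_sub_cancel_left, hz2, ← dist_eq_norm]
    rw [Metric.mem_ball, dist_eq_dist_apply] at h
    exact h

lemma eventually_rpow_le_pow (hS : IsSteep 1 c d κ b) (X : ℕ) :
    ∀ᶠ j : ℕ in atTop, ((8 * j + X : ℕ) : ℝ) ^ d ≤ c / 2 * b ^ j := by
  have hc := hS.c_pos
  have hb := hS.pos
  have h1 := (tendsto_pow_const_div_const_pow_of_one_lt ⌈d⌉₊
    (show 1 < b by linarith [hS.ge_twenty])).const_mul (((8 + X : ℕ) : ℝ) ^ ⌈d⌉₊)
  rw [mul_zero] at h1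
  filter_upwards [h1.eventually (gt_mem_nhds (show 0 < c / 2 by positivity)),
    eventually_ge_atTop 1] with j hj hj1
  have h2 : (1 : ℝ) ≤ ((8 * j + X : ℕ) : ℝ) := by exact_mod_cast (by omega : 1 ≤ 8 * j + X)
  have h3 : ((8 * j + X : ℕ) : ℝ) ≤ ((8 + X : ℕ) : ℝ) * j := by
    have : 8 * j + X ≤ (8 + X) * j := by nlinarith
    exact_mod_cast this
  calc ((8 * j + X : ℕ) : ℝ) ^ d ≤ ((8 * j + X : ℕ) : ℝ) ^ (⌈d⌉₊ : ℝ) :=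
        Real.rpow_le_rpow_of_exponent_le h2 (Nat.le_ceil d)
    _ = ((8 * j + X : ℕ) : ℝ) ^ ⌈d⌉₊ := Real.rpow_natCast _ _
    _ ≤ (((8 + X : ℕ) : ℝ) * j) ^ ⌈d⌉₊ := by gcongr
    _ ≤ c / 2 * b ^ j := by
        rw [mul_pow, ← div_le_iff₀ (by positivity), mul_div_assoc]
        exact hj.le

/-- Off the singular orbit every point is regular up to times much longer than its index. -/
lemma exists_mem_regularUpTo (hS : IsSteep 1 c d κ b) (hρ : IsDiophantine c d ρ) {θ : Torus 1}
    (hθ : ∀ i, 1 ≤ i → θ ≠ i • toTorus ρ) (X : ℕ) :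
    ∃ j m, θ ∈ regularUpTo ρ b j m ∧ 8 * j + X ≤ m := by
  classical
  have hr := hS.inv_pos
  have hr1 := hS.inv_le_one
  have hb := hS.pos
  have hc := hS.c_pos
  by_cases hreg : ∃ j, θ ∈ regular ρ b j
  · obtain ⟨j, hj⟩ := hreg
    exact ⟨j, 8 * j + X, regular_subset_regularUpTo _ _ hj, le_rfl⟩
  have hex : ∀ j, ∃ i, 1 ≤ i ∧ dist θ (i • toTorus ρ) < b⁻¹ ^ (i + j) := by
    intro j
    by_contra hcon
    push Not at hcon
    exact hreg ⟨j, hcon⟩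
  obtain ⟨j₀, hj₀⟩ := eventually_atTop.1 (eventually_rpow_le_pow hS X)
  -- Two close approaches are compared: `i'` is the first violation at level `j₀`, `J` the first
  -- level at which `i'` no longer violates, and `i` the first violation at level `J`. Then `i' <
  -- i`, and both `i • ρ` and `i' • ρ` are within `b⁻¹ ^ J` of `θ`, so the Diophantine condition
  -- makes `i - i'` exponentially large in `J`.
  obtain ⟨i', ⟨hi'1, hi'⟩, hmin'⟩ : ∃ i', (1 ≤ i' ∧ dist θ (i' • toTorus ρ) < b⁻¹ ^ (i' + j₀)) ∧
      ∀ i, 1 ≤ i → dist θ (i • toTorus ρ) < b⁻¹ ^ (i + j₀) → i' ≤ i :=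
    ⟨Nat.find (hex j₀), Nat.find_spec (hex j₀), fun i h1 h2 => Nat.find_min' (hex j₀) ⟨h1, h2⟩⟩
  have hJ : ∃ J, b⁻¹ ^ (i' + J) ≤ dist θ (i' • toTorus ρ) := by
    obtain ⟨J, hJ⟩ := ((tendsto_inv_pow hS).eventually
      (gt_mem_nhds (dist_pos.2 (hθ i' hi'1)))).exists
    exact ⟨J, (pow_le_pow_of_le_one hr.le hr1 (by omega)).trans hJ.le⟩
  obtain ⟨J, hJ1, hJmin⟩ : ∃ J, b⁻¹ ^ (i' + J) ≤ dist θ (i' • toTorus ρ) ∧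
      ∀ J' < J, dist θ (i' • toTorus ρ) < b⁻¹ ^ (i' + J') :=
    ⟨Nat.find hJ, Nat.find_spec hJ, fun J' h => not_le.1 (Nat.find_min hJ h)⟩
  have hJ0 : j₀ < J := by
    by_contra hcon
    exact absurd (hJ1.trans_lt hi') (not_lt.2
      (pow_le_pow_of_le_one hr.le hr1 (by omega)))
  obtain ⟨i, ⟨hi1, hi⟩, hmin⟩ : ∃ i, (1 ≤ i ∧ dist θ (i • toTorus ρ) < b⁻¹ ^ (i + J)) ∧
      ∀ n < i, 1 ≤ n → b⁻¹ ^ (n + J) ≤ dist θ (n • toTorus ρ) :=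
    ⟨Nat.find (hex J), Nat.find_spec (hex J), fun n h1 h2 => by
      by_contra hcon
      exact Nat.find_min (hex J) h1 ⟨h2, not_le.1 hcon⟩⟩
  have hii' : i' ≤ i := hmin' i hi1 (hi.trans_le (pow_le_pow_of_le_one hr.le hr1 (by omega)))
  have hne : i' ≠ i := by
    rintro rfl
    exact absurd hi (not_lt.2 hJ1)
  have hlt : i' < i := lt_of_le_of_ne hii' hne
  refine ⟨J, i - 1, fun n hn hn' => hmin n (by omega) hn, ?_⟩
  by_contra hcon
  have hN : i - i' ≤ 8 * J + X := by omega
  have h1 := hρ.le_norm (n := i - i') (by omega)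
  have h2 : ‖(i - i') • toTorus ρ‖ ≤ dist θ (i • toTorus ρ) + dist θ (i' • toTorus ρ) := by
    have h3 : (i - i') • toTorus ρ = i • toTorus ρ - i' • toTorus ρ := by
      rw [eq_sub_iff_add_eq, ← add_smul, Nat.sub_add_cancel hii']
    rw [h3, ← dist_eq_norm]
    exact dist_triangle_left _ _ _
  have h4 : dist θ (i • toTorus ρ) < b⁻¹ ^ J :=
    hi.trans_le (pow_le_pow_of_le_one hr.le hr1 (by omega))
  have h5 : dist θ (i' • toTorus ρ) < b⁻¹ ^ J :=
    (hJmin (J - 1) (by omega)).trans_le (pow_le_pow_of_le_one hr.le hr1 (by omega))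
  have h6 : ((i - i' : ℕ) : ℝ) ^ d ≤ c / 2 * b ^ J := by
    refine le_trans ?_ (hj₀ J hJ0.le)
    have : ((i - i' : ℕ) : ℝ) ≤ ((8 * J + X : ℕ) : ℝ) := by exact_mod_cast hN
    exact Real.rpow_le_rpow (by positivity) this hS.d_pos.le
  have hpos : (0 : ℝ) < ((i - i' : ℕ) : ℝ) := by exact_mod_cast Nat.sub_pos_of_lt hlt
  have h7 : c < 2 * b⁻¹ ^ J * ((i - i' : ℕ) : ℝ) ^ d := by
    rw [Real.rpow_neg hpos.le, ← div_eq_mul_inv] at h1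
    have h8 : c / ((i - i' : ℕ) : ℝ) ^ d < 2 * b⁻¹ ^ J := by linarith
    rwa [div_lt_iff₀ (by positivity)] at h8
  have h9 : 2 * b⁻¹ ^ J * ((i - i' : ℕ) : ℝ) ^ d ≤ 2 * b⁻¹ ^ J * (c / 2 * b ^ J) := by gcongr
  have h10 : 2 * b⁻¹ ^ J * (c / 2 * b ^ J) = c := by
    rw [inv_pow]; field_simp
  linarith

/-- To the right of a point that is regular up to time `m` there are regular points nearby. -/
lemma exists_mem_regular_right (hS : IsSteep 1 c d κ b) {p : ℝ} {j m : ℕ}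
    (h : circ p ∈ regularUpTo ρ b j m) :
    ∃ p', p < p' ∧ p' < p + b⁻¹ ^ m ∧ circ p' ∈ regular ρ b (j + 1) := by
  have hr := hS.inv_pos
  have hr1 := hS.inv_le_one
  have hr20 := hS.inv_le_one_twentieth
  -- Moving by less than `s` preserves the conditions up to time `m` at level `j + 1`; the balls
  -- excluded at later times are too small to cover the interval.
  set s : ℝ := b⁻¹ ^ (m + j) * (1 - b⁻¹) with hs
  have hpow : 0 < b⁻¹ ^ (m + j) := by positivity
  have hs0 : 0 < s := mul_pos hpow (by linarith)
  have hsm : s ≤ b⁻¹ ^ (m + j) := mul_le_of_le_one_right hpow.le (by linarith)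
  have hsm' : b⁻¹ ^ (m + j) ≤ b⁻¹ ^ m := pow_le_pow_of_le_one hr.le hr1 (by omega)
  by_contra hcon
  push Not at hcon
  have hsub : Metric.ball (circ (p + s / 2)) (s / 2) ⊆
      ⋃ l : ℕ, Metric.ball ((l + (m + 1)) • toTorus ρ) (b⁻¹ ^ (m + j + 2) * b⁻¹ ^ l) := by
    intro θ hθ
    obtain ⟨y, rfl, hy⟩ := exists_circ_eq_of_mem_ball hθ
    rw [abs_lt] at hy
    have hny := hcon y (by linarith) (by linarith)
    simp only [regular, mem_ofPred_eq, not_forall, not_le, exists_prop] at hny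
    obtain ⟨i, hi, hlt⟩ := hny
    have him : m + 1 ≤ i := by
      by_contra hc
      have h1 := h i hi (by omega)
      have h2 : dist (circ p) (circ y) < s := by
        refine (dist_circ_le p y).trans_lt ?_
        rw [abs_lt]; constructor <;> linarith
      have h3 := dist_triangle (circ p) (circ y) (i • toTorus ρ)
      have h4 : b⁻¹ ^ (i + (j + 1)) = b⁻¹ ^ (i + j) * b⁻¹ := by ring
      have h5 : b⁻¹ ^ (m + j) ≤ b⁻¹ ^ (i + j) := pow_le_pow_of_le_one hr.le hr1 (by omega)
      have h6 : s ≤ b⁻¹ ^ (i + j) * (1 - b⁻¹) :=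
        mul_le_mul_of_nonneg_right h5 (by linarith)
      rw [h4] at hlt
      linarith
    refine mem_iUnion.2 ⟨i - (m + 1), ?_⟩
    rw [Nat.sub_add_cancel him, Metric.mem_ball, ← pow_add]
    rwa [show m + j + 2 + (i - (m + 1)) = i + (j + 1) by omega]
  have h1 := (le_leb_real_ball le_rfl (circ (p + s / 2)) (t := s / 2) (by positivity) (by
    have : b⁻¹ ^ (m + j) ≤ 1 := pow_le_one₀ hr.le hr1
    linarith)).trans ((measureReal_mono hsub).trans
      (leb_iUnion_ball_le le_rfl _ (by positivity) hr.le (by linarith)))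
  have h2 : b⁻¹ ^ (m + j + 2) = b⁻¹ ^ (m + j) * (b⁻¹ * b⁻¹) := by ring
  rw [h2] at h1
  simp only [pow_one, Nat.cast_one, div_one] at h1
  have h3 : b⁻¹ * b⁻¹ ≤ 1 / 20 * (1 / 20) := by gcongr
  have h4 : b⁻¹ ^ (m + j) * (b⁻¹ * b⁻¹) ≤ b⁻¹ ^ (m + j) * (1 / 20 * (1 / 20)) := by gcongr
  have h5 : b⁻¹ ^ (m + j) * (1 - 1 / 20) ≤ s := by rw [hs]; gcongr
  linarith

/-- The upper bounding graph has no peaks that are isolated from the right. -/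
lemma exists_right_phiPlus_ge (hS : IsSteep 1 c d κ b) (hρ : IsDiophantine c d ρ) (p : ℝ) {η : ℝ}
    (hη : 0 < η) :
    ∃ p', p < p' ∧ p' < p + η ∧
      (phiPlus ρ κ hκ (circ p) : ℝ) ≤ phiPlus ρ κ hκ (circ p') + η := by
  have hr := hS.inv_pos
  have hb := hS.pos
  by_cases horb : ∀ i, 1 ≤ i → circ p ≠ i • toTorus ρ
  · obtain ⟨X, hX⟩ := ((tendsto_inv_pow hS).eventually
      (gt_mem_nhds (show 0 < η / 2 by positivity))).exists
    -- Here 537 and the factor 8 match `lipConst b (j + 1) = b ^ (537 + 8 * j)`, so that the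
    -- comparison error `lipConst b (j + 1) * 2 * b⁻¹ ^ m` is at most `2 * b⁻¹ ^ X < η`.
    obtain ⟨j, m, hjm, hm⟩ := exists_mem_regularUpTo hS hρ horb (537 + X)
    obtain ⟨p', hp, hp', hreg⟩ := exists_mem_regular_right hS hjm
    have hmX : b⁻¹ ^ m ≤ b⁻¹ ^ X := pow_le_pow_of_le_one hr.le hS.inv_le_one (by omega)
    refine ⟨p', hp, by linarith, ?_⟩
    have hjm' : circ p ∈ regularUpTo ρ b (j + 1) m := fun i hi him =>
      (pow_le_pow_of_le_one hr.le hS.inv_le_one (by omega)).trans (hjm i hi him)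
    have h1 := (abs_le.1 (abs_upperLine_sub_phiPlus_le (hκ := hκ) hS hρ hjm' hreg)).2
    have h2 := phiPlus_le_upperLine (ρ := ρ) (hκ := hκ) m (circ p)
    have h3 : dist (circ p) (circ p') ≤ b⁻¹ ^ m := by
      refine (dist_circ_le p p').trans ?_
      rw [abs_le]; constructor <;> linarith
    have h4 : lipConst b (j + 1) * (dist (circ p) (circ p') + b⁻¹ ^ m) ≤ 2 * b⁻¹ ^ X := by
      have h5 : b⁻¹ ^ m ≤ b⁻¹ ^ (537 + 8 * j) * b⁻¹ ^ X := by
        rw [← pow_add]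
        exact pow_le_pow_of_le_one hr.le hS.inv_le_one (by omega)
      calc lipConst b (j + 1) * (dist (circ p) (circ p') + b⁻¹ ^ m)
          ≤ lipConst b (j + 1) * (2 * (b⁻¹ ^ (537 + 8 * j) * b⁻¹ ^ X)) := by
            have := one_le_lipConst hS (j + 1)
            gcongr
            linarith
        _ = (b * b⁻¹) ^ (537 + 8 * j) * (2 * b⁻¹ ^ X) := by
            rw [lipConst, mul_pow]; ring
        _ = 2 * b⁻¹ ^ X := by rw [mul_inv_cancel₀ hb.ne', one_pow, one_mul]
    linarith
  · push Not at horb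
    obtain ⟨i, hi, hpi⟩ := horb
    refine ⟨p + η / 2, by linarith, by linarith, ?_⟩
    rw [hpi, phiPlus_nsmul hi]
    have := (phiPlus ρ κ hκ (circ (p + η / 2))).2.1
    linarith

/-! ### Intermediate values of `φ⁺` and infinite length of the graph -/

lemma isClosed_le_phiPlus (y : ℝ) : IsClosed {θ : Torus 1 | y ≤ phiPlus ρ κ hκ θ} := by
  have h : {θ : Torus 1 | y ≤ phiPlus ρ κ hκ θ} = ⋂ n, {θ | y ≤ upperLine ρ κ hκ n θ} := by
    ext θ
    simp only [mem_ofPred_eq, mem_iInter]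
    exact ⟨fun h n => h.trans (phiPlus_le_upperLine n θ),
      fun h => ge_of_tendsto' (tendsto_upperLine θ) h⟩
  rw [h]
  exact isClosed_iInter fun n => isClosed_le continuous_const
    (continuous_subtype_val.comp (continuous_upperLine ρ κ hκ n))

/-- Between a point where `φ⁺` is at least `δ` and a zero of `φ⁺` all values in `(0, δ)` are
attained. -/
lemma exists_phiPlus_eq (hS : IsSteep 1 c d κ b) (hρ : IsDiophantine c d ρ) {q τ y δ : ℝ}
    (hqτ : q < τ) (hq : δ ≤ phiPlus ρ κ hκ (circ q)) (hτ : (phiPlus ρ κ hκ (circ τ) : ℝ) = 0)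
    (hy : 0 < y) (hyδ : y < δ) :
    ∃ a, q < a ∧ a < τ ∧ (phiPlus ρ κ hκ (circ a) : ℝ) = y := by
  -- By upper semicontinuity there is a last point `a` in `[q, τ]` with `φ⁺ ≥ y`. Points just to its
  -- right have `φ⁺ < y`, and `a` is not a peak isolated from the right, so the value at `a` is
  -- exactly `y`.
  have hcomp : IsCompact (Icc q τ ∩ circ ⁻¹' {θ | y ≤ phiPlus ρ κ hκ θ}) :=
    isCompact_Icc.inter_right ((isClosed_le_phiPlus y).preimage continuous_circ)
  obtain ⟨a, ⟨⟨hqa, haτ⟩, hya⟩, hmax⟩ := hcomp.exists_isGreatest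
    ⟨q, ⟨le_rfl, hqτ.le⟩, hyδ.le.trans hq⟩
  have hya' : y ≤ phiPlus ρ κ hκ (circ a) := hya
  have haτ' : a < τ := by
    refine lt_of_le_of_ne haτ fun h => ?_
    rw [h, hτ] at hya'
    linarith
  have hay : (phiPlus ρ κ hκ (circ a) : ℝ) = y := by
    refine le_antisymm (le_of_forall_pos_le_add fun ε hε => ?_) hya'
    obtain ⟨p', hp, hp', hle⟩ := exists_right_phiPlus_ge (hκ := hκ) hS hρ a
      (lt_min hε (sub_pos.2 haτ'))
    have h1 : p' < τ := by linarith [min_le_right ε (τ - a)]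
    have h2 : (phiPlus ρ κ hκ (circ p') : ℝ) < y := by
      by_contra hcon
      have := hmax ⟨⟨by linarith, h1.le⟩, not_lt.1 hcon⟩
      linarith
    linarith [min_le_left ε (τ - a)]
  refine ⟨a, lt_of_le_of_ne hqa fun h => ?_, haτ', hay⟩
  rw [h, hay] at hq
  linarith

lemma leb_countable {s : Set (Torus 1)} (hs : s.Countable) : leb 1 s = 0 := by
  rw [← biUnion_of_singleton s]
  refine (measure_biUnion_null_iff hs).2 fun θ _ => ?_
  have h := leb_closedBall_le θ 0
  rw [Metric.closedBall_zero] at h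
  simpa using h

lemma exists_circ_eq (θ : Torus 1) : ∃ x ∈ Ico (0 : ℝ) 1, circ x = θ := by
  refine ⟨AddCircle.equivIco 1 0 (θ 0), ?_, ?_⟩
  · have h := (AddCircle.equivIco (1 : ℝ) 0 (θ 0)).2
    simpa using h
  · ext i
    rw [Subsingleton.elim i 0]
    exact AddCircle.coe_equivIco

/-- Otherwise `{φ⁺ > 0}` would be countable, hence null, although it contains `regular 1`, which has
positive measure. -/
lemma exists_infinite_phiPlus_ge (hS : IsSteep 1 c d κ b) (hρ : IsDiophantine c d ρ) :
    ∃ δ : ℝ, 0 < δ ∧ {x | x ∈ Ico (0 : ℝ) 1 ∧ δ ≤ phiPlus ρ κ hκ (circ x)}.Infinite := by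
  by_contra hcon
  push Not at hcon
  have hcount : (⋃ n : ℕ, {x | x ∈ Ico (0 : ℝ) 1 ∧
      1 / ((n : ℝ) + 1) ≤ phiPlus ρ κ hκ (circ x)}).Countable :=
    countable_iUnion fun n => (hcon _ (by positivity)).countable
  have hsub : regular ρ b 1 ⊆ circ '' (⋃ n : ℕ, {x | x ∈ Ico (0 : ℝ) 1 ∧
      1 / ((n : ℝ) + 1) ≤ phiPlus ρ κ hκ (circ x)}) := by
    intro θ hθ
    obtain ⟨x, hx, rfl⟩ := exists_circ_eq θ
    obtain ⟨n, hn⟩ := exists_nat_one_div_lt (phiPlus_pos (hκ := hκ) hS hρ hθ)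
    exact ⟨x, mem_iUnion.2 ⟨n, hx, hn.le⟩, rfl⟩
  have h0 : (leb 1).real (regular ρ b 1) = 0 := by
    rw [measureReal_eq_zero_iff]
    exact measure_mono_null hsub (leb_countable (hcount.image _))
  have h1 := leb_compl_regular_le (ρ := ρ) hS 1
  have h2 := probReal_add_probReal_compl (μ := leb 1)
    (isClosed_regular (ρ := ρ) (b := b) 1).measurableSet
  have h3 := hS.inv_le_one_twentieth
  rw [pow_one] at h1
  linarith

lemma injOn_circ : InjOn circ (Ico (0 : ℝ) 1) := by
  intro x hx y hy h
  have h1 : ((x : ℝ) : UnitAddCircle) = y := congrArg (fun θ : Torus 1 => θ 0) h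
  have h2 := (AddCircle.coe_eq_coe_iff_of_mem_Ico (p := (1 : ℝ)) (a := 0)
    (by simpa using hx) (by simpa using hy)).1 h1
  exact h2

/-- The open arc of points with representatives between `q` and `q'`. -/
def arc (q q' : ℝ) : Set (Torus 1) := circ '' Ioo q q'

lemma isOpen_arc (q q' : ℝ) : IsOpen (arc q q') := by
  have h : arc q q' = (fun θ : Torus 1 => θ 0) ⁻¹' ((fun x : ℝ => (x : UnitAddCircle)) '' Ioo q q') := by
    ext θ
    constructor
    · rintro ⟨x, hx, rfl⟩
      exact ⟨x, hx, rfl⟩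
    · rintro ⟨x, hx, hxθ⟩
      refine ⟨x, hx, ?_⟩
      ext i
      rw [Subsingleton.elim i 0]
      exact hxθ
  rw [h]
  exact (QuotientAddGroup.isOpenMap_coe _ isOpen_Ioo).preimage (by fun_prop)

/-- The Diophantine condition excludes periodicity, so the multiples of `ρ` are dense. The multiple
0, where `φ⁺` need not vanish, is avoided because `0 ≤ q`. -/
lemma exists_nsmul_mem_arc (hS : IsSteep 1 c d κ b) (hρ : IsDiophantine c d ρ) {q q' : ℝ}
    (hq : 0 ≤ q) (hqq' : q < q') (hq' : q' ≤ 1) :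
    ∃ x ∈ Ioo q q', ∃ n : ℕ, 1 ≤ n ∧ circ x = n • toTorus ρ := by
  have hc := hS.c_pos
  have hord : addOrderOf ((ρ 0 : ℝ) : UnitAddCircle) = 0 := by
    rw [addOrderOf_eq_zero_iff']
    intro n hn h0
    have h1 := hρ.le_norm (n := n) hn
    have h2 : n • toTorus ρ = 0 := by
      ext i
      rw [Subsingleton.elim i 0]
      exact h0
    rw [h2, norm_zero] at h1
    have : (0 : ℝ) < n := by exact_mod_cast hn
    have : 0 < c * (n : ℝ) ^ (-d) := by positivity
    linarith
  have hdense := denseRange_zsmul_iff_nsmul.1 (AddCircle.denseRange_zsmul_iff.2 hord)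
  obtain ⟨n, x, hx, hxn⟩ := hdense.exists_mem_open
    (QuotientAddGroup.isOpenMap_coe (N := AddSubgroup.zmultiples (1 : ℝ)) (Ioo q q') isOpen_Ioo)
    ((nonempty_Ioo.2 hqq').image _)
  have hxn' : circ x = n • toTorus ρ := by
    ext i
    rw [Subsingleton.elim i 0]
    exact hxn
  refine ⟨x, hx, n, ?_, hxn'⟩
  by_contra hn
  have hn0 : n = 0 := by omega
  rw [hn0, zero_smul] at hxn'
  have h0 : circ 0 = 0 := by
    ext i
    simp [circ, toTorus]
  have := injOn_circ ⟨hq.trans hx.1.le, hx.2.trans_le hq'⟩ ⟨le_rfl, one_pos⟩ (hxn'.trans h0.symm)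
  linarith [hx.1]

/-- Projection to the fibre is 1-Lipschitz and maps the graph over the arc onto a set containing
`(0, δ)`. -/
lemma ofReal_le_hausdorffMeasure_graphOver_arc (hS : IsSteep 1 c d κ b)
    (hρ : IsDiophantine c d ρ) {q q' δ : ℝ} (hq : 0 ≤ q) (hqq' : q < q') (hq' : q' ≤ 1)
    (hδ : δ ≤ phiPlus ρ κ hκ (circ q)) :
    ENNReal.ofReal δ ≤ μH[1] (graphOver ρ κ hκ (arc q q')) := by
  obtain ⟨τ, hτ, n, hn, hτn⟩ := exists_nsmul_mem_arc hS hρ hq hqq' hq'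
  have hτ0 : (phiPlus ρ κ hκ (circ τ) : ℝ) = 0 := by rw [hτn, phiPlus_nsmul hn]
  have hsub : Ioo 0 δ ⊆ (fun p : Torus 1 × I => (p.2 : ℝ)) '' graphOver ρ κ hκ (arc q q') := by
    intro y hy
    obtain ⟨a, hqa, haτ, ha⟩ := exists_phiPlus_eq hS hρ hτ.1 hδ hτ0 hy.1 hy.2
    exact ⟨(circ a, phiPlus ρ κ hκ (circ a)), ⟨⟨a, ⟨hqa, haτ.trans hτ.2⟩, rfl⟩, rfl⟩, ha⟩
  have hlip : LipschitzWith 1 (fun p : Torus 1 × I => (p.2 : ℝ)) :=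
    LipschitzWith.of_dist_le_mul fun p p' => by
      rw [NNReal.coe_one, one_mul]; exact le_max_right _ _
  have h1 := hlip.hausdorffMeasure_image_le (d := 1) zero_le_one (graphOver ρ κ hκ (arc q q'))
  have h2 := measure_mono (μ := (μH[1] : Measure ℝ)) hsub
  rw [hausdorffMeasure_real, Real.volume_Ioo, sub_zero, ← hausdorffMeasure_real] at h2
  simpa using h2.trans h1

theorem hausdorffMeasure_graphPlus_eq_top (hS : IsSteep 1 c d κ b) (hρ : IsDiophantine c d ρ) :
    μH[1] (graphPlus ρ κ hκ) = ∞ := by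
  obtain ⟨δ, hδ, hinf⟩ := exists_infinite_phiPlus_ge (hκ := hκ) hS hρ
  have hbound : ∀ K : ℕ, (K : ℝ≥0∞) * ENNReal.ofReal δ ≤ μH[1] (graphPlus ρ κ hκ) := by
    intro K
    -- Consecutive elements of `K + 1` ordered points bound `K` disjoint arcs.
    obtain ⟨s, hs, hcard⟩ := hinf.exists_subset_card_eq (K + 1)
    let e := s.orderEmbOfFin hcard
    have he : ∀ i, e i ∈ Ico (0 : ℝ) 1 ∧ δ ≤ phiPlus ρ κ hκ (circ (e i)) := fun i =>
      hs (s.orderEmbOfFin_mem hcard i)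
    have hlt : ∀ i : Fin K, e i.castSucc < e i.succ := fun i =>
      e.strictMono (Fin.castSucc_lt_succ)
    have hdisj : Pairwise (Function.onFun Disjoint fun i : Fin K =>
        graphOver ρ κ hκ (arc (e i.castSucc) (e i.succ))) := by
      have key : ∀ i i' : Fin K, i < i' → Disjoint
          (graphOver ρ κ hκ (arc (e i.castSucc) (e i.succ)))
          (graphOver ρ κ hκ (arc (e i'.castSucc) (e i'.succ))) := by
        intro i i' hii'
        rw [Set.disjoint_left]
        rintro p ⟨⟨x, hx, hxp⟩, -⟩ ⟨⟨y, hy, hyp⟩, -⟩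
        have hxy : x = y := injOn_circ
          ⟨(he _).1.1.trans hx.1.le, hx.2.trans (he _).1.2⟩
          ⟨(he _).1.1.trans hy.1.le, hy.2.trans (he _).1.2⟩ (hxp.trans hyp.symm)
        have hle : e i.succ ≤ e i'.castSucc := e.monotone (Fin.succ_le_castSucc_iff.2 hii')
        linarith [hx.2, hy.1]
      intro i i' hne
      rcases lt_or_gt_of_ne hne with h | h
      · exact key i i' h
      · exact (key i' i h).symm
    calc (K : ℝ≥0∞) * ENNReal.ofReal δ = ∑ _i : Fin K, ENNReal.ofReal δ := by simp
      _ ≤ ∑ i : Fin K, μH[1] (graphOver ρ κ hκ (arc (e i.castSucc) (e i.succ))) :=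
          Finset.sum_le_sum fun i _ => ofReal_le_hausdorffMeasure_graphOver_arc hS hρ
            (he _).1.1 (hlt i) (he _).1.2.le (he _).2
      _ = μH[1] (⋃ i : Fin K, graphOver ρ κ hκ (arc (e i.castSucc) (e i.succ))) := by
          rw [measure_iUnion hdisj fun i =>
            measurableSet_graphOver (isOpen_arc _ _).measurableSet, tsum_fintype]
      _ ≤ μH[1] (graphPlus ρ κ hκ) := by
          rw [graphPlus_eq_graphOver_univ]
          exact measure_mono (iUnion_subset fun i => graphOver_mono (subset_univ _))
  by_contra hne
  obtain ⟨K, hK⟩ := ENNReal.exists_nat_mul_gt (a := ENNReal.ofReal δ)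
    (ENNReal.ofReal_pos.2 hδ).ne' hne
  exact absurd (hbound K) (not_le.2 hK)

end OneDim

/-- All conditions bound `b` from below, so `b = κ ^ (1 / 64)` works once `κ` exceeds the 64th power
of the largest bound. -/
lemma exists_isSteep {c d : ℝ} (hc : 0 < c) (hd : 0 < d) {D : ℕ} (hD : 1 ≤ D) :
    ∃ κ₀ : ℝ, ∀ κ, 0 < κ → κ₀ ≤ κ → ∃ b, IsSteep D c d κ b := by
  set C := (2 * D / c) ^ (1 / d) / (1 - Real.exp (-(1 / d))) + 1
  have hM : 0 < max (16 * D + 2 ^ (D + 1) : ℝ) (Real.exp C) := lt_max_of_lt_right (Real.exp_pos _)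
  refine ⟨max (16 * D + 2 ^ (D + 1) : ℝ) (Real.exp C) ^ 64, fun κ hκ hκ₀ => ?_⟩
  have hpow : (κ ^ ((64 : ℕ) : ℝ)⁻¹) ^ 64 = κ := Real.rpow_inv_natCast_pow hκ.le (by norm_num)
  have hb0 : 0 < κ ^ ((64 : ℕ) : ℝ)⁻¹ := by positivity
  have hb : max (16 * D + 2 ^ (D + 1) : ℝ) (Real.exp C) ≤ κ ^ ((64 : ℕ) : ℝ)⁻¹ := by
    rw [← hpow] at hκ₀
    exact le_of_pow_le_pow_left₀ (by norm_num) hb0.le hκ₀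
  exact ⟨_, hD, hc, hd, hpow, (le_max_left _ _).trans hb,
    (Real.le_log_iff_exp_le hb0).2 ((le_max_right _ _).trans hb)⟩

end PinchedSkew

theorem corollaryc (c d : ℝ) (hc : 0 < c) (hd : 1 < d) :
    ∃ D₀ : ℕ, ∀ D : ℕ, 1 ≤ D → ∃ κ₀ : ℝ, ∀ (κ : ℝ) (hκ : 0 < κ), κ₀ ≤ κ →
      ∀ ρ : Fin D → ℝ, PinchedSkew.IsDiophantine c d ρ →
        dimH (PinchedSkew.graphPlus ρ κ hκ) = (D : ℝ≥0∞) ∧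
        (D = 1 → μH[(D : ℝ)] (PinchedSkew.graphPlus ρ κ hκ) = ∞) ∧
        (D₀ ≤ D → μH[(D : ℝ)] (PinchedSkew.graphPlus ρ κ hκ) < ∞) ∧
        PinchedSkew.IsExactDimensional (PinchedSkew.muPlus ρ κ hκ) (D : EReal) ∧
        PinchedSkew.HasInformationDim (PinchedSkew.muPlus ρ κ hκ) (D : EReal) ∧
        PinchedSkew.IsRectifiableMeasure D (PinchedSkew.muPlus ρ κ hκ) := by
  refine ⟨16, fun D hD => ?_⟩
  obtain ⟨κ₀, h⟩ := PinchedSkew.exists_isSteep hc (by linarith : 0 < d) hD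
  refine ⟨κ₀, fun κ hκ hκ₀ ρ hρ => ?_⟩
  obtain ⟨b, hS⟩ := h κ hκ hκ₀
  refine ⟨PinchedSkew.dimH_graphPlus hS hρ, ?_,
    PinchedSkew.hausdorffMeasure_graphPlus_lt_top hS hρ,
    PinchedSkew.isExactDimensional_muPlus hS hρ, PinchedSkew.hasInformationDim_muPlus hS hρ,
    PinchedSkew.isRectifiableMeasure_muPlus hS hρ⟩
  rintro rfl
  rw [Nat.cast_one]
  exact PinchedSkew.hausdorffMeasure_graphPlus_eq_top hS hρ
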